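/- Let $F=F(x_1,\dots,x_k)$ be the free group of rank $k\ge 2$ with free basis $A=\{x_1,\dots,x_k\}$, and let $H\le F$ be any subgroup. Let $H_A\subseteq (A\cup A^{-1})^*$ be the set of all words (reduced or not) representing elements of $H$. Let $a_n$ (respectively $r_n$) be the number of freely reduced words of length exactly $n$ (respectively at most $n$) in $H_A$, and let $b_n$ (respectively $z_n$) be the number of all words of length exactly $n$ (respectively at most $n$) in $H_A$. Let $\Gamma$ be the Schreier coset graph of $H$: its vertices are the cosets $Hg$, $g\in F$; for each coset $Hg$ and each letter $l\in A\cup A^{-1}$ there is an oriented edge labelled $l$ from $Hg$ to $Hgl$, and its inverse is the edge labelled $l^{-1}$ from $Hgl$ to $Hg$. Let $\alpha=\limsup_n \sqrt[n]{a_n(\Gamma)}$ and $\beta=\limsup_n\sqrt[n]{b_n(\Gamma)}$, where $a_n(\Gamma)$ (respectively $b_n(\Gamma)$) is the number of edge-paths without backtracks (respectively of all edge-paths) of length $n$ in $\Gamma$ from the vertex $H1$ to itself. The graph $\Gamma$ is called amenable if its spectral radius $\nu=\beta/(2k)$ equals $1$. A sequence $s_n\ge 0$ with $s_n\to 0$ converges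 exponentially fast if there are $0\le\sigma<1$ and $C>0$ with $s_n\le C\sigma^n$ for all $n\ge 1$. Then $\Gamma$ is a $2k$-regular graph (each vertex is the origin of exactly $2k$ oriented edges), $\alpha\le 2k-1$ and $\beta\le 2k$. The ball of radius $n$ around $1$ in $F$ with respect to $A$ has exactly $1+\frac{k}{k-1}\left[(2k-1)^n-1\right]$ elements for every $n\ge 0$. Moreover: 1. If $[F:H]=\infty$ then $$\lim_{n\to\infty}\frac{a_n}{(2k-1)^n}=\lim_{n\to\infty}\frac{r_n}{(2k-1)^n}=0,\qquad \lim_{n\to\infty}\frac{b_n}{(2k)^n}=\lim_{n\to\infty}\frac{z_n}{(2k)^n}=0 .$$ Moreover $H$ has zero asymptotic density, both among words and among group elements: $$\lim_{n\to\infty}\frac{z_n}{\#\{w\in(A\cup A^{-1})^*:|w|\le n\}}=0,\qquad \lim_{n\to\infty}\frac{\#\{h\in H: |h|_A\le n\}}{\#\{g\in F: |g|_A\le n\}}=0,$$ where $|w|$ is the length of the word $w$ and $|g|_A$ is the length of the reduced word representing $g$. 2. If $\Gamma$ is non-amenable, then $[F:H]=\infty$ and all the limits in part 1 converge to zero exponentially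 fast. 3. If $[F:H]<\infty$ then $$\limsup_{n\to\infty}\frac{a_n}{(2k-1)^n}>0,\quad \limsup_{n\to\infty}\frac{r_n}{(2k-1)^n}>0,\quad \limsup_{n\to\infty}\frac{b_n}{(2k)^n}>0,\quad \limsup_{n\to\infty}\frac{z_n}{(2k)^n}>0 .$$ -/

import Mathlib

open Filter Topology
open scoped ENNReal

/-- A graph in which loops and multiple edges are allowed: every (oriented) edge `e` has an origin
`o e`, a terminus `t e` and a formal inverse edge `inv e ≠ e`. -/
structure SerreGraph (V E : Type*) where
  o : E → V
  t : E → V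
  inv : E → E
  o_inv : ∀ e, o (inv e) = t e
  t_inv : ∀ e, t (inv e) = o e
  inv_inv : ∀ e, inv (inv e) = e
  inv_ne : ∀ e, inv e ≠ e

namespace SerreGraph

variable {V E : Type*} (Γ : SerreGraph V E)

/-- Every vertex is the origin of exactly `d` oriented edges. -/
def IsRegular (d : ℕ) : Prop :=
  ∀ v : V, {e : E | Γ.o e = v}.encard = d

/-- `Γ.IsPath u p v`: the list of oriented edges `p` is an edge-path from `u` to `v`. -/
def IsPath : V → List E → V → Prop
  | u, [], v => u = v
  | u, e :: p, v => Γ.o e = u ∧ IsPath (Γ.t e) p v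

/-- A sequence of edges without backtracks: no edge is followed by its inverse. -/
def IsReduced (p : List E) : Prop :=
  p.IsChain fun e f => f ≠ Γ.inv e

/-- The number of reduced paths of length `n` from `x₀` to `x₀`. -/
noncomputable def numReducedClosedPaths (x₀ : V) (n : ℕ) : ℕ :=
  {p : List E | Γ.IsPath x₀ p x₀ ∧ Γ.IsReduced p ∧ p.length = n}.ncard

/-- The number of all paths of length `n` from `x₀` to `x₀`. -/
noncomputable def numClosedPaths (x₀ : V) (n : ℕ) : ℕ :=
  {p : List E | Γ.IsPath x₀ p x₀ ∧ p.length = n}.ncard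

/-- The cogrowth rate `α`, the limsup of the `n`-th roots of the numbers of reduced closed paths.
Taken in `[0, ∞]`, so that the limsup is always a genuine one. -/
noncomputable def cogrowthRate (x₀ : V) : ℝ≥0∞ :=
  limsup (fun n : ℕ => (Γ.numReducedClosedPaths x₀ n : ℝ≥0∞) ^ (1 / (n : ℝ))) atTop

/-- The non-reduced cogrowth rate `β`. -/
noncomputable def nonReducedCogrowthRate (x₀ : V) : ℝ≥0∞ :=
  limsup (fun n : ℕ => (Γ.numClosedPaths x₀ n : ℝ≥0∞) ^ (1 / (n : ℝ))) atTop

/-- The spectral radius `ν = β / d` of a `d`-regular graph. -/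
noncomputable def spectralRadius (d : ℕ) (x₀ : V) : ℝ≥0∞ :=
  Γ.nonReducedCogrowthRate x₀ / (d : ℝ≥0∞)

/-- Amenability of a `d`-regular graph with base-vertex `x₀`: the spectral radius is `1`. -/
def IsAmenable (d : ℕ) (x₀ : V) : Prop :=
  Γ.spectralRadius d x₀ = 1

end SerreGraph

namespace CosetGraph

variable {A : Type*}

/-- The set `{H g | g ∈ F}` of right cosets of `H` in the free group `F` on `A`. -/
abbrev Vertex (H : Subgroup (FreeGroup A)) : Type _ :=
  Quotient (QuotientGroup.rightRel H)

/-- The coset `H 1`. -/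
def base (H : Subgroup (FreeGroup A)) : Vertex H :=
  Quotient.mk'' 1

/-- Right multiplication of cosets, `(H g, h) ↦ H (g h)`. -/
def mulRight (H : Subgroup (FreeGroup A)) (v : Vertex H) (h : FreeGroup A) : Vertex H :=
  Quotient.map' (fun g => g * h)
    (fun x y hxy => by
      rw [QuotientGroup.rightRel_apply] at hxy ⊢
      simpa [mul_assoc] using hxy) v

theorem mulRight_mul (H : Subgroup (FreeGroup A)) (v : Vertex H) (g h : FreeGroup A) :
    mulRight H (mulRight H v g) h = mulRight H v (g * h) := by
  induction v using Quotient.inductionOn'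
  simp [mulRight, mul_assoc]

theorem mulRight_one (H : Subgroup (FreeGroup A)) (v : Vertex H) :
    mulRight H v 1 = v := by
  induction v using Quotient.inductionOn'
  simp [mulRight]

/-- The inverse letter. The letter `(x, true)` is `x` and the letter `(x, false)` is `x⁻¹`. -/
def invLetter (l : A × Bool) : A × Bool := (l.1, !l.2)

theorem mk_letter_mul_inv (l : A × Bool) :
    FreeGroup.mk [l] * FreeGroup.mk [invLetter l] = 1 := by
  obtain ⟨x, b⟩ := l
  have h : FreeGroup.mk [invLetter (x, b)] = (FreeGroup.mk [(x, b)])⁻¹ := by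
    simp [invLetter, FreeGroup.inv_mk, FreeGroup.invRev]
  rw [h, mul_inv_cancel]

/-- The Schreier coset graph of the subgroup `H` of the free group on `A`. Its vertices are the
cosets `H g`. For each letter `l ∈ A ∪ A⁻¹` and each coset `H g` there is an edge `(H g, l)` with
label `l` from `H g` to `H g l`, whose inverse is the edge `(H g l, l⁻¹)`. -/
def graph (H : Subgroup (FreeGroup A)) : SerreGraph (Vertex H) (Vertex H × (A × Bool)) where
  o e := e.1
  t e := mulRight H e.1 (FreeGroup.mk [e.2])
  inv e := (mulRight H e.1 (FreeGroup.mk [e.2]), invLetter e.2)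
  o_inv _ := rfl
  t_inv e := by
    rw [mulRight_mul, mk_letter_mul_inv, mulRight_one]
  inv_inv e := by
    refine Prod.ext ?_ ?_
    · change mulRight H (mulRight H e.1 _) _ = e.1
      rw [mulRight_mul, mk_letter_mul_inv, mulRight_one]
    · simp [invLetter]
  inv_ne e h := by
    have h2 := congrArg (fun e => e.2.2) h
    simp [invLetter] at h2

end CosetGraph

section Words

variable {A : Type*}

/-- The set `H_A` of all words in `A ∪ A⁻¹` representing elements of `H`. -/
def wordsRepresenting (H : Subgroup (FreeGroup A)) : Set (List (A × Bool)) :=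
  {w | FreeGroup.mk w ∈ H}

/-- `a_n`: the number of freely reduced words of length `n` representing elements of `H`. -/
noncomputable def numReducedWords (H : Subgroup (FreeGroup A)) (n : ℕ) : ℕ :=
  {w : List (A × Bool) |
    w ∈ wordsRepresenting H ∧ FreeGroup.IsReduced w ∧ w.length = n}.ncard

/-- `r_n`: the number of freely reduced words of length `≤ n` representing elements of `H`. -/
noncomputable def numReducedWordsLE (H : Subgroup (FreeGroup A)) (n : ℕ) : ℕ :=
  {w : List (A × Bool) |
    w ∈ wordsRepresenting H ∧ FreeGroup.IsReduced w ∧ w.length ≤ n}.ncard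

/-- `b_n`: the number of all words of length `n` representing elements of `H`. -/
noncomputable def numWords (H : Subgroup (FreeGroup A)) (n : ℕ) : ℕ :=
  {w : List (A × Bool) | w ∈ wordsRepresenting H ∧ w.length = n}.ncard

/-- `z_n`: the number of all words of length `≤ n` representing elements of `H`. -/
noncomputable def numWordsLE (H : Subgroup (FreeGroup A)) (n : ℕ) : ℕ :=
  {w : List (A × Bool) | w ∈ wordsRepresenting H ∧ w.length ≤ n}.ncard

end Words

/-- `ρ_n(S)`: the proportion of the words of length at most `n` over the finite alphabet `X` that
lie in `S`. -/
noncomputable def wordDensity {X : Type*} (S : Set (List X)) (n : ℕ) : ℝ :=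
  ((S ∩ {w | w.length ≤ n}).ncard : ℝ) / ({w : List X | w.length ≤ n}.ncard : ℝ)

/-- The `n`-ball around the identity in the Cayley graph of a free group with respect to its free
basis, that is, the set of the elements whose reduced word has length at most `n`. -/
def freeBall (A : Type*) [DecidableEq A] (n : ℕ) : Set (FreeGroup A) :=
  {g | g.norm ≤ n}

/-- The proportion of the elements of the `n`-ball of a free group (of finite rank) that lie in
`S`. -/
noncomputable def ballDensity {A : Type*} [DecidableEq A] (S : Set (FreeGroup A)) (n : ℕ) : ℝ :=
  ((S ∩ freeBall A n).ncard : ℝ) / ((freeBall A n).ncard : ℝ)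

/-- The nonnegative sequence `s` converges to zero exponentially fast. -/
def TendsToZeroExpFast (s : ℕ → ℝ) : Prop :=
  (∀ n, 0 ≤ s n) ∧ Tendsto s atTop (𝓝 0) ∧
    ∃ σ C : ℝ, 0 ≤ σ ∧ σ < 1 ∧ 0 < C ∧ ∀ n : ℕ, 1 ≤ n → s n ≤ C * σ ^ n

/-! Write q = 2k - 1, let T = `adj` be the adjacency operator of the coset graph, and let M_n be the
operator summing over reduced words of length n (`sphereSum`). Applied to the indicator of the base
vertex and evaluated there, T^n gives b_n and M_n gives a_n. Sorting products of a letter and a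
reduced word by whether they cancel yields T M_1 = M_2 + 2k and T M_n = M_(n+1) + q M_(n-1) for n ≥
2.

Infinite index. T is symmetric, so the sum over edges of the squared differences between f_n = T^n f
/ (2k)^n and f_(n+1) equals 2k (|f_n|^2 - |f_(n+1)|^2). The norms decrease, so this energy tends to
0 and f_n(vl) - f_(n+1)(v) → 0 on every edge (`wordSum_energy`). For M_n / q^n the same holds up to
a geometrically small error, because M_n^2 - M_(n-1) M_(n+1) is q^(n-2) times a fixed operator
(`pair_sphereSum_defect`). Functions of bounded mass that become equal along all edges of an
infinite connected graph must vanish in the limit (`tendsto_base_of_infinite`).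

Finite index. The mass is constant and the recurrences bound values at neighbours, so decay at the
base would spread to all of the finitely many vertices and destroy the mass
(`not_tendsto_base_of_finite`).

Non-amenable case. If β < 2k, the Green series at t = z/(2k) converges for some z > 1. Applied to
M_n it gives numbers c_n ≥ a_n, and the recurrence forces c_(n+1) ≤ (q/z) c_n for n ≥ 1
(`numReducedWords_le_of_summable`). Decay of b_n also excludes finite index.

Cumulative counts and densities follow by summing geometric bounds. -/

namespace CosetGraph

/-! ### Walking along letters in the coset graph. -/

variable {A : Type*} {H : Subgroup (FreeGroup A)}

/-- The neighbour `H (g l)` of the vertex `H g` of the coset graph. -/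
def step (v : Vertex H) (l : A × Bool) : Vertex H :=
  mulRight H v (FreeGroup.mk [l])

@[simp]
theorem invLetter_invLetter (l : A × Bool) : invLetter (invLetter l) = l := by
  simp [invLetter]

/-- Inversion of letters as a permutation of the alphabet. -/
def invLetterEquiv (A : Type*) : Equiv.Perm (A × Bool) :=
  ⟨invLetter, invLetter, invLetter_invLetter, invLetter_invLetter⟩

@[simp]
theorem step_step_invLetter (v : Vertex H) (l : A × Bool) : step (step v l) (invLetter l) = v := by
  rw [step, step, mulRight_mul, mk_letter_mul_inv, mulRight_one]

@[simp]
theorem step_invLetter_step (v : Vertex H) (l : A × Bool) : step (step v (invLetter l)) l = v := by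
  simpa using step_step_invLetter v (invLetter l)

/-- Moving along the edges with a given label permutes the vertices. -/
def stepEquiv (H : Subgroup (FreeGroup A)) (l : A × Bool) : Equiv.Perm (Vertex H) :=
  ⟨fun v => step v l, fun v => step v (invLetter l), fun v => step_step_invLetter v l,
    fun v => step_invLetter_step v l⟩

theorem mulRight_mk_cons (v : Vertex H) (l : A × Bool) (w : List (A × Bool)) :
    mulRight H v (FreeGroup.mk (l :: w)) = mulRight H (step v l) (FreeGroup.mk w) := by
  rw [step, mulRight_mul, FreeGroup.mul_mk, List.singleton_append]

theorem mulRight_mk_nil (v : Vertex H) : mulRight H v (FreeGroup.mk []) = v :=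
  mulRight_one H v

theorem mulRight_base_eq_base_iff (g : FreeGroup A) :
    mulRight H (base H) g = base H ↔ g ∈ H := by
  change Quotient.mk'' (1 * g) = Quotient.mk'' 1 ↔ _
  rw [Quotient.eq'', QuotientGroup.rightRel_apply]
  simp

theorem exists_eq_mulRight_base (v : Vertex H) :
    ∃ w : List (A × Bool), v = mulRight H (base H) (FreeGroup.mk w) := by
  induction v using Quotient.inductionOn' with
  | h g =>
    induction g using Quot.inductionOn with
    | h w => exact ⟨w, by change _ = Quotient.mk'' (1 * FreeGroup.mk w); rw [one_mul]; rfl⟩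

/-- Induction along the edges of the coset graph, starting at the base vertex. -/
theorem vertex_induction {P : Vertex H → Prop} (h0 : P (base H))
    (h : ∀ v l, P v → P (step v l)) (v : Vertex H) : P v := by
  have key : ∀ (w : List (A × Bool)) (u : Vertex H), P u →
      P (mulRight H u (FreeGroup.mk w)) := by
    intro w
    induction w with
    | nil => intro u hu; rwa [mulRight_mk_nil]
    | cons l w ih => intro u hu; rw [mulRight_mk_cons]; exact ih _ (h u l hu)
  obtain ⟨w, rfl⟩ := exists_eq_mulRight_base v
  exact key w _ h0

theorem isReduced_cons_iff (l : A × Bool) (w : List (A × Bool)) :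
    FreeGroup.IsReduced (l :: w) ↔ w.head? ≠ some (invLetter l) ∧ FreeGroup.IsReduced w := by
  cases w with
  | nil => simp
  | cons m w =>
    rw [FreeGroup.isReduced_cons_cons]
    refine and_congr_left fun _ => ?_
    obtain ⟨x, b⟩ := l
    obtain ⟨y, c⟩ := m
    simp only [invLetter, List.head?_cons, ne_eq, Option.some.injEq, Prod.mk.injEq, not_and]
    constructor
    · rintro h rfl
      have := h rfl
      subst this
      simp
    · rintro h rfl
      have := h rfl
      revert this
      cases b <;> cases c <;> simp

end CosetGraph

/-! ### Counting words by first letter and by length. -/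

/-- The predicate is arbitrary so that the same recursion serves all words and reduced words. -/
theorem ncard_words_succ {L : Type*} [Fintype L] (P : List L → Prop) (n : ℕ) :
    {w | P w ∧ w.length = n + 1}.ncard = ∑ l, {w | P (l :: w) ∧ w.length = n}.ncard := by
  have hfin : ∀ (Q : List L → Prop) (m : ℕ), Finite ↥{w | Q w ∧ w.length = m} := fun Q m =>
    ((List.finite_length_eq L m).subset fun w hw => hw.2).to_subtype
  have e : ↥{w | P w ∧ w.length = n + 1} ≃ Σ l, ↥{w | P (l :: w) ∧ w.length = n} :=
    { toFun := fun w => match w with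
        | ⟨[], h⟩ => absurd h.2 (by simp)
        | ⟨l :: w, h⟩ => ⟨l, w, h.1, by simpa using h.2⟩
      invFun := fun x => ⟨x.1 :: x.2.1, x.2.2.1, by simpa using x.2.2.2⟩
      left_inv := by
        rintro ⟨_ | ⟨l, w⟩, h⟩
        · exact absurd h.2 (by simp)
        · rfl
      right_inv := by
        rintro ⟨l, w, h⟩
        rfl }
  have := hfin
  rw [← Nat.card_coe_set_eq, Nat.card_congr e, Nat.card_sigma]
  simp only [Nat.card_coe_set_eq]

theorem ncard_words_le_succ {L : Type*} [Finite L] (P : List L → Prop) (n : ℕ) :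
    {w | P w ∧ w.length ≤ n + 1}.ncard =
      {w | P w ∧ w.length ≤ n}.ncard + {w | P w ∧ w.length = n + 1}.ncard := by
  rw [← Set.ncard_union_eq ?_ ((List.finite_length_le L n).subset fun w hw => hw.2)
    ((List.finite_length_eq L (n + 1)).subset fun w hw => hw.2)]
  · congr 1
    ext w
    simp only [Set.mem_ofPred_eq, Set.mem_union, ← and_or_left]
    refine and_congr_right fun _ => ?_
    omega
  · rw [Set.disjoint_left]
    rintro w ⟨_, h⟩ ⟨_, h'⟩
    omega

namespace CosetGraph

variable {A : Type*} {H : Subgroup (FreeGroup A)}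

/-! ### Adjacency and sphere operators and their recurrences. -/

section Operators

variable [Fintype A]

/-- The adjacency operator of the coset graph. -/
noncomputable def adj (f : Vertex H → ℝ) (v : Vertex H) : ℝ :=
  ∑ l, f (step v l)

/-- The sum of `f` over the ends of the words of length `n` that start at `v`. -/
noncomputable def wordSum (f : Vertex H → ℝ) (n : ℕ) : Vertex H → ℝ :=
  adj^[n] f

variable [DecidableEq A]

/-- The sum of `f` over the ends of the reduced words of length `n` that start at `v` and whose
first letter is not the inverse of `l`. -/
noncomputable def coneSum (f : Vertex H → ℝ) : ℕ → Vertex H → A × Bool → ℝ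
  | 0, v, _ => f v
  | n + 1, v, l => ∑ m, if m = invLetter l then 0 else coneSum f n (step v m) m

/-- The sum of `f` over the ends of the reduced words of length `n` that start at `v`. -/
noncomputable def sphereSum (f : Vertex H → ℝ) : ℕ → Vertex H → ℝ
  | 0, v => f v
  | n + 1, v => ∑ l, coneSum f n (step v l) l

omit [DecidableEq A] in
@[simp]
theorem wordSum_zero (f : Vertex H → ℝ) : wordSum f 0 = f := rfl

omit [DecidableEq A] in
theorem wordSum_succ (f : Vertex H → ℝ) (n : ℕ) : wordSum f (n + 1) = adj (wordSum f n) :=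
  Function.iterate_succ_apply' _ _ _

@[simp]
theorem sphereSum_zero (f : Vertex H → ℝ) : sphereSum f 0 = f := rfl

theorem coneSum_nonneg {f : Vertex H → ℝ} (hf : ∀ v, 0 ≤ f v) (n : ℕ) (v : Vertex H)
    (l : A × Bool) : 0 ≤ coneSum f n v l := by
  induction n generalizing v l with
  | zero => exact hf v
  | succ n ih =>
    refine Finset.sum_nonneg fun m _ => ?_
    split_ifs
    exacts [le_rfl, ih _ _]

theorem sphereSum_nonneg {f : Vertex H → ℝ} (hf : ∀ v, 0 ≤ f v) (n : ℕ) (v : Vertex H) :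
    0 ≤ sphereSum f n v := by
  cases n with
  | zero => exact hf v
  | succ n => exact Finset.sum_nonneg fun m _ => coneSum_nonneg hf _ _ _

omit [DecidableEq A] in
theorem adj_nonneg {f : Vertex H → ℝ} (hf : ∀ v, 0 ≤ f v) (v : Vertex H) : 0 ≤ adj f v :=
  Finset.sum_nonneg fun _ _ => hf _

omit [DecidableEq A] in
theorem wordSum_nonneg {f : Vertex H → ℝ} (hf : ∀ v, 0 ≤ f v) (n : ℕ) (v : Vertex H) :
    0 ≤ wordSum f n v := by
  induction n generalizing v with
  | zero => exact hf v
  | succ n ih => rw [wordSum_succ]; exact adj_nonneg ih v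

/-- Reduced words either do or do not start with the inverse of the letter `l`. -/
theorem sphereSum_succ_eq (f : Vertex H → ℝ) (n : ℕ) (v : Vertex H) (l : A × Bool) :
    sphereSum f (n + 1) v =
      coneSum f (n + 1) v l + coneSum f n (step v (invLetter l)) (invLetter l) := by
  rw [sphereSum, coneSum, ← Finset.sum_erase_add _ _ (Finset.mem_univ (invLetter l)),
    ← Finset.sum_erase_add (a := invLetter l) _ (fun m => if m = invLetter l then (0 : ℝ) else _)
      (Finset.mem_univ _)]
  simp only [if_true, add_zero]
  congr 1
  refine Finset.sum_congr rfl fun m hm => ?_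
  rw [if_neg (Finset.ne_of_mem_erase hm)]

theorem sphereSum_one (f : Vertex H → ℝ) : sphereSum f 1 = adj f := rfl

/-- Each of the 2k letters can be cancelled to the empty word; from length 2 on only 2k - 1
cancellations lead to a given word, so this case is exceptional. -/
theorem adj_sphereSum_one (f : Vertex H → ℝ) (v : Vertex H) :
    adj (sphereSum f 1) v = sphereSum f 2 v + 2 * Fintype.card A * f v := by
  have h : ∀ l, sphereSum f 1 (step v l) = coneSum f 1 (step v l) l + f v := fun l => by
    rw [sphereSum_succ_eq f 0 _ l, step_step_invLetter, coneSum]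
  rw [adj, Finset.sum_congr rfl fun l _ => h l, Finset.sum_add_distrib]
  congr 1
  simp only [Finset.sum_const, Finset.card_univ, Fintype.card_prod, Fintype.card_bool,
    nsmul_eq_mul]
  push_cast
  ring

/-- A product of a letter and a reduced word either is reduced or cancels. A reduced word u of
positive length arises by cancellation from l · (l⁻¹u) for every letter l except its own first
letter, hence the factor 2k - 1. -/
theorem adj_sphereSum_add_two (f : Vertex H → ℝ) (n : ℕ) (v : Vertex H) :
    adj (sphereSum f (n + 2)) v =
      sphereSum f (n + 3) v + (2 * Fintype.card A - 1) * sphereSum f (n + 1) v := by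
  have h : ∀ l, sphereSum f (n + 2) (step v l) = coneSum f (n + 2) (step v l) l +
      (sphereSum f (n + 1) v - coneSum f n (step v l) l) := fun l => by
    rw [sphereSum_succ_eq f (n + 1) _ l, step_step_invLetter,
      sphereSum_succ_eq f n v (invLetter l), invLetter_invLetter]
    ring
  rw [adj, Finset.sum_congr rfl fun l _ => h l, Finset.sum_add_distrib, Finset.sum_sub_distrib]
  change sphereSum f (n + 3) v + (_ - sphereSum f (n + 1) v) = _
  simp [Fintype.card_prod]
  ring

end Operators

/-! ### Word counts as values of the operators. -/

section Counting

variable [Fintype A]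

open Classical in
/-- The indicator function of the base vertex. -/
noncomputable def baseIndicator (H : Subgroup (FreeGroup A)) (v : Vertex H) : ℝ :=
  if v = base H then 1 else 0

omit [Fintype A] in
theorem baseIndicator_nonneg (v : Vertex H) : 0 ≤ baseIndicator H v := by
  unfold baseIndicator
  split_ifs <;> norm_num

/-- The starting vertex varies while the end stays at the base, so that removing the first letter
stays within the statement. -/
theorem ncard_words_ending_at_base (n : ℕ) (v : Vertex H) :
    ({w : List (A × Bool) | mulRight H v (FreeGroup.mk w) = base H ∧ w.length = n}.ncard : ℝ) =
      wordSum (baseIndicator H) n v := by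
  induction n generalizing v with
  | zero =>
    by_cases hv : v = base H
    · have : {w : List (A × Bool) | mulRight H v (FreeGroup.mk w) = base H ∧ w.length = 0}
          = {[]} := by
        ext w
        simp only [Set.mem_ofPred_eq, List.length_eq_zero_iff, Set.mem_singleton_iff]
        refine ⟨fun h => h.2, ?_⟩
        rintro rfl
        exact ⟨by rwa [mulRight_mk_nil], rfl⟩
      rw [this]; simp [baseIndicator, hv]
    · have : {w : List (A × Bool) | mulRight H v (FreeGroup.mk w) = base H ∧ w.length = 0}
          = ∅ := by
        ext w
        simp only [Set.mem_ofPred_eq, List.length_eq_zero_iff, Set.mem_empty_iff_false, iff_false]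
        rintro ⟨h, rfl⟩
        exact hv (by rwa [mulRight_mk_nil] at h)
      rw [this]; simp [baseIndicator, hv]
  | succ n ih =>
    rw [ncard_words_succ, wordSum_succ, adj, Nat.cast_sum]
    simp only [mulRight_mk_cons, ih]

theorem numWords_eq (n : ℕ) : (numWords H n : ℝ) = wordSum (baseIndicator H) n (base H) := by
  rw [← ncard_words_ending_at_base]
  simp only [mulRight_base_eq_base_iff]
  rfl

variable [DecidableEq A]

theorem ncard_reduced_words_ending_at_base_cone (n : ℕ) (v : Vertex H) (l : A × Bool) :
    ({w : List (A × Bool) | (mulRight H v (FreeGroup.mk w) = base H ∧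
      FreeGroup.IsReduced (l :: w)) ∧ w.length = n}.ncard : ℝ) =
      coneSum (baseIndicator H) n v l := by
  induction n generalizing v l with
  | zero =>
    rw [coneSum, ← wordSum_zero (baseIndicator H), ← ncard_words_ending_at_base]
    congr 2
    ext w
    simp only [Set.mem_ofPred_eq, List.length_eq_zero_iff]
    refine and_congr_left ?_
    rintro rfl
    simp
  | succ n ih =>
    rw [ncard_words_succ, coneSum, Nat.cast_sum]
    refine Finset.sum_congr rfl fun m _ => ?_
    split_ifs with hm
    · subst hm
      have : {w : List (A × Bool) | (mulRight H v (FreeGroup.mk (invLetter l :: w)) = base H ∧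
          FreeGroup.IsReduced (l :: invLetter l :: w)) ∧ w.length = n} = ∅ := by
        ext w
        simp only [isReduced_cons_iff l, List.head?_cons]
        simp
      rw [this]; simp
    · rw [← ih]
      congr 2
      ext w
      simp only [Set.mem_ofPred_eq, mulRight_mk_cons, isReduced_cons_iff l (m :: w),
        List.head?_cons, ne_eq, Option.some.injEq, hm, not_false_iff, true_and]

theorem numReducedWords_eq (n : ℕ) :
    (numReducedWords H n : ℝ) = sphereSum (baseIndicator H) n (base H) := by
  have h1 : numReducedWords H n = {w : List (A × Bool) |
      (mulRight H (base H) (FreeGroup.mk w) = base H ∧ FreeGroup.IsReduced w) ∧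
        w.length = n}.ncard := by
    simp only [mulRight_base_eq_base_iff, and_assoc]
    rfl
  rw [h1]
  cases n with
  | zero =>
    rw [sphereSum_zero, ← wordSum_zero (baseIndicator H), ← ncard_words_ending_at_base]
    congr 2
    ext w
    simp only [Set.mem_ofPred_eq, List.length_eq_zero_iff]
    refine and_congr_left ?_
    rintro rfl
    simp
  | succ n =>
    rw [ncard_words_succ, sphereSum, Nat.cast_sum]
    refine Finset.sum_congr rfl fun m _ => ?_
    rw [← ncard_reduced_words_ending_at_base_cone]
    simp only [mulRight_mk_cons]

end Counting

end CosetGraph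

/-! ### Pairing, mass and energy estimates. -/

theorem tendsto_sub_succ_of_antitone {u : ℕ → ℝ} (hu : Antitone u) {b : ℝ} (hb : ∀ n, b ≤ u n) :
    Tendsto (fun n => u n - u (n + 1)) atTop (𝓝 0) := by
  have h := tendsto_atTop_ciInf hu ⟨b, by rintro _ ⟨n, rfl⟩; exact hb n⟩
  simpa using h.sub (h.comp (tendsto_add_atTop_nat 1))

theorem tendsto_zero_of_sq_le {x y : ℕ → ℝ} (h : ∀ n, x n ^ 2 ≤ y n)
    (hy : Tendsto y atTop (𝓝 0)) : Tendsto x atTop (𝓝 0) := by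
  have h2 : Tendsto (fun n => x n ^ 2) atTop (𝓝 0) :=
    squeeze_zero (fun n => sq_nonneg _) h hy
  have h3 := (Real.continuous_sqrt.tendsto 0).comp h2
  rw [Real.sqrt_zero] at h3
  refine (tendsto_zero_iff_abs_tendsto_zero _).2 (h3.congr fun n => ?_)
  simp [Real.sqrt_sq_eq_abs]

namespace CosetGraph

variable {A : Type*} {H : Subgroup (FreeGroup A)}

/-- The pairing `∑ f v * g v` of functions on the vertices of the coset graph. -/
noncomputable def pair (f g : Vertex H → ℝ) : ℝ := ∑' v, f v * g v

theorem summable_mul_left {f : Vertex H → ℝ} (hf : f.support.Finite) (g : Vertex H → ℝ) :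
    Summable fun v => f v * g v :=
  summable_of_hasFiniteSupport (hf.subset (Function.support_mul_subset_left _ _))

theorem pair_comm (f g : Vertex H → ℝ) : pair f g = pair g f := by
  simp only [pair, mul_comm]

theorem pair_self_nonneg (f : Vertex H → ℝ) : 0 ≤ pair f f :=
  tsum_nonneg fun v => mul_self_nonneg (f v)

theorem pair_add_smul {f f' : Vertex H → ℝ} (hf : f.support.Finite) (hf' : f'.support.Finite)
    (c : ℝ) (g : Vertex H → ℝ) :
    pair (fun v => f v + c * f' v) g = pair f g + c * pair f' g := by
  simp only [pair]
  rw [← tsum_mul_left, ← (summable_mul_left hf g).tsum_add ((summable_mul_left hf' g).mul_left c)]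
  refine tsum_congr fun v => ?_
  ring

theorem pair_smul_smul (c d : ℝ) (f g : Vertex H → ℝ) :
    pair (fun v => c * f v) (fun v => d * g v) = c * d * pair f g := by
  simp only [pair]
  rw [← tsum_mul_left]
  refine tsum_congr fun v => ?_
  ring

theorem finite_support_comp_step {f : Vertex H → ℝ} (hf : f.support.Finite) (l : A × Bool) :
    (Function.support fun v => f (step v l)).Finite :=
  hf.preimage (stepEquiv H l).injective.injOn

theorem finite_support_baseIndicator : (baseIndicator H).support.Finite := by
  refine (Set.finite_singleton (base H)).subset fun v hv => ?_
  by_contra h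
  exact hv (if_neg h)

theorem tsum_baseIndicator : ∑' v, baseIndicator H v = 1 := by
  classical
  refine (tsum_eq_single (base H) fun v hv => if_neg hv).trans (if_pos rfl)

variable [Fintype A]

theorem finite_support_adj {f : Vertex H → ℝ} (hf : f.support.Finite) :
    (adj f).support.Finite := by
  refine (Set.finite_iUnion fun l => finite_support_comp_step hf l).subset fun v hv => ?_
  by_contra h
  simp only [Set.mem_iUnion, Function.mem_support, not_exists, not_not] at h
  exact hv (Finset.sum_eq_zero fun l _ => h l)

theorem finite_support_wordSum {f : Vertex H → ℝ} (hf : f.support.Finite) (n : ℕ) :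
    (wordSum f n).support.Finite := by
  induction n with
  | zero => exact hf
  | succ n ih => rw [wordSum_succ]; exact finite_support_adj ih

theorem tsum_adj {f : Vertex H → ℝ} (hf : f.support.Finite) :
    ∑' v, adj f v = 2 * Fintype.card A * ∑' v, f v := by
  simp only [adj]
  rw [Summable.tsum_finsetSum fun l _ => summable_of_hasFiniteSupport (finite_support_comp_step hf l)]
  rw [Finset.sum_congr rfl fun l _ =>
    show ∑' v, f (step v l) = ∑' v, f v from (stepEquiv H l).tsum_eq f]
  simp only [Finset.sum_const, Finset.card_univ, Fintype.card_prod, Fintype.card_bool,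
    nsmul_eq_mul]
  push_cast
  ring

theorem pair_adj_left {f : Vertex H → ℝ} (hf : f.support.Finite) (g : Vertex H → ℝ) :
    pair (adj f) g = ∑ l, ∑' v, f (step v l) * g v := by
  simp only [pair, adj, Finset.sum_mul]
  exact Summable.tsum_finsetSum fun l _ => summable_mul_left (finite_support_comp_step hf l) g

/-- The adjacency operator is symmetric. -/
theorem pair_adj_comm {f g : Vertex H → ℝ} (hf : f.support.Finite) (hg : g.support.Finite) :
    pair (adj f) g = pair f (adj g) := by
  -- The steps along l and l⁻¹ are inverse permutations of the vertices, so reindexing letters by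
  -- inversion exchanges the two factors.
  rw [pair_adj_left hf, pair_comm f, pair_adj_left hg, ← Equiv.sum_comp (invLetterEquiv A)]
  refine Finset.sum_congr rfl fun l _ => ?_
  rw [← (stepEquiv H l).tsum_eq]
  refine tsum_congr fun v => ?_
  change f (step (step v l) (invLetter l)) * g (step v l) = _
  rw [step_step_invLetter, mul_comm]

/-- The energy estimate along an edge. -/
theorem sq_sub_le_energy {f g : Vertex H → ℝ} (hf : f.support.Finite) (hg : g.support.Finite)
    (v : Vertex H) (l : A × Bool) :
    (f (step v l) - g v) ^ 2 ≤
      2 * Fintype.card A * pair f f - 2 * pair (adj f) g + 2 * Fintype.card A * pair g g := by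
  have hs1 : ∀ m, Summable fun u => f (step u m) * f (step u m) := fun m =>
    summable_mul_left (finite_support_comp_step hf m) _
  have hs2 : ∀ m, Summable fun u => f (step u m) * g u := fun m =>
    summable_mul_left (finite_support_comp_step hf m) _
  have hs3 : Summable fun u => g u * g u := summable_mul_left hg _
  -- A step permutes the vertices, so shifting f preserves its norm and only the cross term depends
  -- on the letter.
  have hs : ∀ m, HasSum (fun u => (f (step u m) - g u) ^ 2)
      (pair f f - 2 * ∑' u, f (step u m) * g u + pair g g) := by
    intro m
    have h1 : ∑' u, f (step u m) * f (step u m) = pair f f :=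
      (stepEquiv H m).tsum_eq fun u => f u * f u
    rw [← h1]
    refine (((hs1 m).hasSum.sub ((hs2 m).hasSum.mul_left 2)).add hs3.hasSum).congr_fun ?_
    intro u
    ring
  calc (f (step v l) - g v) ^ 2
      ≤ ∑' u, (f (step u l) - g u) ^ 2 :=
        (hs l).summable.le_tsum v fun u _ => sq_nonneg _
    _ ≤ ∑ m, ∑' u, (f (step u m) - g u) ^ 2 :=
        Finset.single_le_sum (f := fun m => ∑' u, (f (step u m) - g u) ^ 2)
          (fun m _ => tsum_nonneg fun u => sq_nonneg _) (Finset.mem_univ l)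
    _ = _ := by
        rw [Finset.sum_congr rfl fun m _ => (hs m).tsum_eq, pair_adj_left hf,
          Finset.sum_add_distrib, Finset.sum_sub_distrib, ← Finset.mul_sum]
        simp only [Finset.sum_const, Finset.card_univ, Fintype.card_prod, Fintype.card_bool,
          nsmul_eq_mul]
        push_cast
        ring

theorem tsum_wordSum {f : Vertex H → ℝ} (hf : f.support.Finite) (n : ℕ) :
    ∑' v, wordSum f n v = (2 * Fintype.card A) ^ n * ∑' v, f v := by
  induction n with
  | zero => simp
  | succ n ih => rw [wordSum_succ, tsum_adj (finite_support_wordSum hf n), ih]; ring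

/-- With g the normalised image of f under `adj`, the cross term of the energy becomes a multiple of
the norm of g, and the energy is exactly a difference of consecutive squared norms. -/
theorem wordSum_energy (f : Vertex H → ℝ) (n : ℕ) (hA : 0 < Fintype.card A)
    (hf : f.support.Finite) (v : Vertex H) (l : A × Bool) :
    (wordSum f n (step v l) / (2 * Fintype.card A) ^ n -
      wordSum f (n + 1) v / (2 * Fintype.card A) ^ (n + 1)) ^ 2 ≤
    2 * Fintype.card A * (pair (wordSum f n) (wordSum f n) / ((2 * Fintype.card A) ^ n) ^ 2 -
      pair (wordSum f (n + 1)) (wordSum f (n + 1)) / ((2 * Fintype.card A) ^ (n + 1)) ^ 2) := by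
  have hA' : (0 : ℝ) < Fintype.card A := by exact_mod_cast hA
  set d : ℝ := 2 * Fintype.card A with hd
  have hdpos : 0 < d := by positivity
  have h := sq_sub_le_energy (f := wordSum f n) (g := fun v => d⁻¹ * wordSum f (n + 1) v)
    (finite_support_wordSum hf n)
    ((finite_support_wordSum hf (n + 1)).subset (Function.support_mul_subset_right _ _)) v l
  have e1 : pair (adj (wordSum f n)) (fun v => d⁻¹ * wordSum f (n + 1) v) =
      d⁻¹ * pair (wordSum f (n + 1)) (wordSum f (n + 1)) := by
    rw [← wordSum_succ]
    simpa using pair_smul_smul 1 d⁻¹ (wordSum f (n + 1)) (wordSum f (n + 1))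
  rw [e1, pair_smul_smul, ← hd] at h
  have h2 := mul_le_mul_of_nonneg_left h (by positivity : 0 ≤ ((d ^ n)⁻¹) ^ 2)
  refine le_of_eq_of_le ?_ (h2.trans_eq ?_)
  · field_simp; ring
  · field_simp; ring

theorem tendsto_wordSum_step_sub {f : Vertex H → ℝ} (hf : f.support.Finite)
    (hA : 0 < Fintype.card A) (v : Vertex H) (l : A × Bool) :
    Tendsto (fun n => wordSum f n (step v l) / (2 * Fintype.card A : ℝ) ^ n -
      wordSum f (n + 1) v / (2 * Fintype.card A : ℝ) ^ (n + 1)) atTop (𝓝 0) := by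
  have hA' : (0 : ℝ) < Fintype.card A := by exact_mod_cast hA
  refine tendsto_zero_of_sq_le (fun n => wordSum_energy f n hA hf v l) ?_
  rw [← mul_zero (2 * Fintype.card A : ℝ)]
  refine Tendsto.const_mul _ (tendsto_sub_succ_of_antitone (u := fun n =>
    pair (wordSum f n) (wordSum f n) / ((2 * Fintype.card A : ℝ) ^ n) ^ 2)
    (antitone_nat_of_succ_le fun n => ?_) (b := 0)
    fun n => div_nonneg (pair_self_nonneg _) (by positivity))
  -- Monotonicity of the norms comes from the same estimate: the difference dominates a square.
  have h := (sq_nonneg _).trans (wordSum_energy f n hA hf v l)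
  have h2 := nonneg_of_mul_nonneg_right h (by positivity)
  linarith

variable [DecidableEq A]

theorem sphereSum_two (f : Vertex H → ℝ) :
    sphereSum f 2 = fun v => adj (sphereSum f 1) v + (-(2 * Fintype.card A)) * f v := by
  ext v
  rw [adj_sphereSum_one]
  ring

theorem sphereSum_add_three (f : Vertex H → ℝ) (n : ℕ) :
    sphereSum f (n + 3) = fun v =>
      adj (sphereSum f (n + 2)) v + (-(2 * Fintype.card A - 1)) * sphereSum f (n + 1) v := by
  ext v
  rw [adj_sphereSum_add_two]
  ring

omit [Fintype A] [DecidableEq A] in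
theorem finite_support_add_smul {f g : Vertex H → ℝ} (hf : f.support.Finite)
    (hg : g.support.Finite) (c : ℝ) : (Function.support fun v => f v + c * g v).Finite := by
  refine (hf.union hg).subset fun v hv => ?_
  by_contra h
  simp only [Set.mem_union, Function.mem_support, not_or, not_not] at h
  exact hv (by simp [h.1, h.2])

theorem finite_support_sphereSum {f : Vertex H → ℝ} (hf : f.support.Finite) :
    ∀ n, (sphereSum f n).support.Finite
  | 0 => hf
  | 1 => finite_support_adj hf
  | 2 => by
    rw [sphereSum_two]
    exact finite_support_add_smul (finite_support_adj (finite_support_sphereSum hf 1)) hf _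
  | n + 3 => by
    rw [sphereSum_add_three]
    exact finite_support_add_smul (finite_support_adj (finite_support_sphereSum hf (n + 2)))
      (finite_support_sphereSum hf (n + 1)) _

omit [Fintype A] [DecidableEq A] in
theorem tsum_add_smul {f g : Vertex H → ℝ} (hf : f.support.Finite)
    (hg : g.support.Finite) (c : ℝ) :
    ∑' v, (f v + c * g v) = ∑' v, f v + c * ∑' v, g v := by
  rw [← tsum_mul_left]
  exact (summable_of_hasFiniteSupport hf).tsum_add ((summable_of_hasFiniteSupport hg).mul_left c)

theorem tsum_sphereSum {f : Vertex H → ℝ} (hf : f.support.Finite) :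
    ∀ n, ∑' v, sphereSum f (n + 1) v =
      2 * Fintype.card A * (2 * Fintype.card A - 1) ^ n * ∑' v, f v
  | 0 => by rw [sphereSum_one, tsum_adj hf]; ring
  | 1 => by
    rw [sphereSum_two, tsum_add_smul (finite_support_adj (finite_support_sphereSum hf 1)) hf,
      tsum_adj (finite_support_sphereSum hf 1), tsum_sphereSum hf 0]
    ring
  | n + 2 => by
    rw [sphereSum_add_three, tsum_add_smul
      (finite_support_adj (finite_support_sphereSum hf (n + 2)))
      (finite_support_sphereSum hf (n + 1)), tsum_adj (finite_support_sphereSum hf (n + 2)),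
      tsum_sphereSum hf (n + 1), tsum_sphereSum hf n]
    ring

/-- The sphere operators are almost log-linear: the defect in `M_n ^ 2 = M_{n-1} M_{n+1}` is an
explicit multiple of a fixed operator. -/
theorem pair_sphereSum_defect {f : Vertex H → ℝ} (hf : f.support.Finite) (n : ℕ) :
    pair (sphereSum f (n + 2)) (sphereSum f (n + 2)) -
        pair (sphereSum f (n + 1)) (sphereSum f (n + 3)) =
      (2 * Fintype.card A - 1) ^ n * (pair (sphereSum f 2) (sphereSum f 2) -
        pair (sphereSum f 1) (sphereSum f 3)) := by
  have hs := finite_support_sphereSum hf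
  induction n with
  | zero => simp
  | succ n ih =>
    -- Expanding one factor of each pairing by the recurrence leaves the same cross term twice; it
    -- drops out of the difference, and the defect is multiplied by 2k - 1.
    have e1 : pair (sphereSum f (n + 3)) (sphereSum f (n + 3)) =
        pair (adj (sphereSum f (n + 2))) (sphereSum f (n + 3)) +
          -(2 * Fintype.card A - 1) * pair (sphereSum f (n + 1)) (sphereSum f (n + 3)) := by
      conv_lhs => enter [1]; rw [sphereSum_add_three]
      exact pair_add_smul (finite_support_adj (hs _)) (hs _) _ _
    have e2 : pair (sphereSum f (n + 2)) (sphereSum f (n + 4)) =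
        pair (adj (sphereSum f (n + 2))) (sphereSum f (n + 3)) +
          -(2 * Fintype.card A - 1) * pair (sphereSum f (n + 2)) (sphereSum f (n + 2)) := by
      rw [pair_comm, sphereSum_add_three f (n + 1),
        pair_add_smul (finite_support_adj (hs _)) (hs _), pair_adj_comm (hs _) (hs _), pair_comm]
    change pair (sphereSum f (n + 3)) (sphereSum f (n + 3)) -
      pair (sphereSum f (n + 2)) (sphereSum f (n + 4)) = _
    rw [e1, e2, pow_succ, mul_right_comm, ← ih]
    ring

/-- The cross term contains the pairing of spheres n + 1 and n + 3, which the defect formula turns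
into the norm of sphere n + 2. What remains is a telescoping difference and the error 2c / q^(n+4).
-/
theorem sphereSum_energy {f : Vertex H → ℝ} (hf : f.support.Finite) (hA : 1 < Fintype.card A)
    (n : ℕ) (v : Vertex H) (l : A × Bool) {q : ℝ} (hq : q = 2 * Fintype.card A - 1) {c : ℝ}
    (hc : c = pair (sphereSum f 2) (sphereSum f 2) - pair (sphereSum f 1) (sphereSum f 3)) :
    (sphereSum f (n + 2) (step v l) / q ^ (n + 2) - sphereSum f (n + 3) v / q ^ (n + 3)) ^ 2 ≤
      (q - 1) * (pair (sphereSum f (n + 2)) (sphereSum f (n + 2)) / (q ^ (n + 2)) ^ 2 -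
        pair (sphereSum f (n + 3)) (sphereSum f (n + 3)) / (q ^ (n + 3)) ^ 2) +
      2 * c / q ^ (n + 4) := by
  have hs := finite_support_sphereSum hf
  have hA' : (1 : ℝ) < Fintype.card A := by exact_mod_cast hA
  have hqpos : 0 < q := by linarith
  have h := sq_sub_le_energy (f := sphereSum f (n + 2))
    (g := fun v => q⁻¹ * sphereSum f (n + 3) v) (hs _)
    ((hs (n + 3)).subset (Function.support_mul_subset_right _ _)) v l
  have e1 : pair (adj (sphereSum f (n + 2))) (fun v => q⁻¹ * sphereSum f (n + 3) v) =
      q⁻¹ * (pair (sphereSum f (n + 3)) (sphereSum f (n + 3)) +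
        q * (pair (sphereSum f (n + 2)) (sphereSum f (n + 2)) - q ^ n * c)) := by
    have e2 := pair_sphereSum_defect hf n
    rw [← hq, ← hc] at e2
    rw [← e2]
    have e3 : adj (sphereSum f (n + 2)) =
        fun v => sphereSum f (n + 3) v + q * sphereSum f (n + 1) v := by
      ext v
      rw [adj_sphereSum_add_two, hq]
    have e4 := pair_add_smul (hs (n + 3)) (hs (n + 1)) q (sphereSum f (n + 3))
    rw [← e3] at e4
    have e5 := pair_smul_smul 1 q⁻¹ (adj (sphereSum f (n + 2))) (sphereSum f (n + 3))
    simp only [one_mul] at e5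
    rw [e5, e4]
    ring
  have hd : (2 * Fintype.card A : ℝ) = q + 1 := by linarith
  rw [e1, pair_smul_smul, hd] at h
  have h2 := mul_le_mul_of_nonneg_left h (by positivity : 0 ≤ ((q ^ (n + 2))⁻¹) ^ 2)
  refine le_of_eq_of_le ?_ (h2.trans_eq ?_)
  · field_simp; ring
  · field_simp; ring

theorem tendsto_sphereSum_step_sub {f : Vertex H → ℝ} (hf : f.support.Finite)
    (hA : 1 < Fintype.card A) (v : Vertex H) (l : A × Bool) {q : ℝ}
    (hq : q = 2 * Fintype.card A - 1) :
    Tendsto (fun n => sphereSum f n (step v l) / q ^ n - sphereSum f (n + 1) v / q ^ (n + 1))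
      atTop (𝓝 0) := by
  have hA' : (1 : ℝ) < Fintype.card A := by exact_mod_cast hA
  have hq1 : 1 < q := by linarith
  obtain ⟨c, hc⟩ : ∃ c, c = pair (sphereSum f 2) (sphereSum f 2) -
    pair (sphereSum f 1) (sphereSum f 3) := ⟨_, rfl⟩
  -- The constant solves (q - 1)(e/q^n - e/q^(n+1)) = 2c/q^(n+4), so adding e/q^n to the norms
  -- absorbs the error into the telescoping difference.
  set e : ℝ := 2 * c / q ^ 3 / (q - 1) ^ 2 with he
  set u : ℕ → ℝ := fun n =>
    pair (sphereSum f (n + 2)) (sphereSum f (n + 2)) / (q ^ (n + 2)) ^ 2 + e / q ^ n with hu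
  have key : ∀ n, (sphereSum f (n + 2) (step v l) / q ^ (n + 2) -
      sphereSum f (n + 3) v / q ^ (n + 3)) ^ 2 ≤ (q - 1) * (u n - u (n + 1)) := by
    intro n
    refine (sphereSum_energy hf hA n v l hq hc).trans_eq ?_
    have : q - 1 ≠ 0 := by linarith
    have h0 : q ≠ 0 := by linarith
    simp only [hu, he]
    field_simp
    ring
  refine (tendsto_add_atTop_iff_nat 2).1 (tendsto_zero_of_sq_le key ?_)
  rw [← mul_zero (q - 1)]
  refine Tendsto.const_mul _ (tendsto_sub_succ_of_antitone
    (antitone_nat_of_succ_le fun n => ?_) (b := -|e|) fun n => ?_)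
  · have h := (sq_nonneg _).trans (key n)
    have h2 := nonneg_of_mul_nonneg_right h (by linarith)
    linarith
  · have h1 : |e / q ^ n| ≤ |e| := by
      rw [abs_div, abs_of_pos (a := q ^ n) (by positivity)]
      exact div_le_self (abs_nonneg _) (one_le_pow₀ hq1.le)
    have h2 : 0 ≤ pair (sphereSum f (n + 2)) (sphereSum f (n + 2)) / (q ^ (n + 2)) ^ 2 :=
      div_nonneg (pair_self_nonneg _) (by positivity)
    have h3 := neg_abs_le (e / q ^ n)
    simp only [hu]
    linarith

end CosetGraph

/-! ### Behaviour at the base vertex for infinite and finite index. -/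

namespace CosetGraph

variable {A : Type*} {H : Subgroup (FreeGroup A)}

/-- On an infinite coset graph, distributions of bounded mass that are asymptotically invariant
along the edges vanish asymptotically at the base vertex. -/
theorem tendsto_base_of_infinite [Infinite (Vertex H)] {f : ℕ → Vertex H → ℝ}
    (hf : ∀ n v, 0 ≤ f n v) {C : ℝ} (hC : ∀ n (S : Finset (Vertex H)), ∑ v ∈ S, f n v ≤ C)
    (h : ∀ v l, Tendsto (fun n => f n (step v l) - f (n + 1) v) atTop (𝓝 0)) :
    Tendsto (fun n => f n (base H)) atTop (𝓝 0) := by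
  -- The hypothesis compares neighbours at consecutive times only. Sums over two consecutive times
  -- remove this parity shift and can be compared at equal times.
  set s : ℕ → Vertex H → ℝ := fun n v => f n v + f (n + 1) v with hs
  have h1 : ∀ v, Tendsto (fun n => s n v - s n (base H)) atTop (𝓝 0) := by
    refine vertex_induction (by simp) fun v l hv => ?_
    have h2 := h v l
    have h3 := h (step v l) (invLetter l)
    rw [step_step_invLetter] at h3
    have h4 := (hv.add h2).sub h3
    simp only [add_zero, sub_zero] at h4
    refine h4.congr fun n => ?_
    simp only [hs]
    ring
  have hsC : ∀ n (S : Finset (Vertex H)), ∑ v ∈ S, s n v ≤ 2 * C := fun n S => by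
    rw [Finset.sum_add_distrib]
    linarith [hC n S, hC (n + 1) S]
  have hs0 : Tendsto (fun n => s n (base H)) atTop (𝓝 0) := by
    rw [Metric.tendsto_atTop]
    intro ε hε
    -- If the base value were at least ε, then M vertices with almost the same value would have mass
    -- above Mε - 1, which exceeds the bound 2C.
    obtain ⟨M, hM⟩ := exists_nat_gt ((2 * C + 1) / ε)
    obtain ⟨S, hS⟩ := Infinite.exists_subset_card_eq (Vertex H) M
    have h5 : Tendsto (fun n => ∑ v ∈ S, (s n v - s n (base H))) atTop (𝓝 0) := by
      simpa using tendsto_finsetSum S fun v _ => h1 v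
    obtain ⟨N, hN⟩ := Metric.tendsto_atTop.1 h5 1 one_pos
    refine ⟨N, fun n hn => ?_⟩
    have h6 := hN n hn
    rw [Real.dist_0_eq_abs, abs_lt, Finset.sum_sub_distrib, Finset.sum_const, hS,
      nsmul_eq_mul] at h6
    have h7 : 0 ≤ s n (base H) := add_nonneg (hf _ _) (hf _ _)
    rw [Real.dist_0_eq_abs, abs_of_nonneg h7]
    by_contra! hcon
    have h8 := hsC n S
    rw [div_lt_iff₀ hε] at hM
    have h9 : (M : ℝ) * ε ≤ M * s n (base H) := by gcongr
    linarith [h6.1]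
  exact squeeze_zero (fun n => hf n _) (fun n => le_add_of_nonneg_right (hf (n + 1) _)) hs0

/-- On a finite coset graph, distributions of constant positive mass which satisfy a Harnack
inequality do not vanish asymptotically at the base vertex. -/
theorem not_tendsto_base_of_finite [Finite (Vertex H)] {f : ℕ → Vertex H → ℝ}
    (hf : ∀ n v, 0 ≤ f n v) {m : ℝ} (hm : m ≠ 0) (hmass : ∀ n, ∑' v, f (n + 1) v = m) {C : ℝ}
    (h : ∀ n v l, f (n + 2) (step v l) ≤ C * (f (n + 3) v + f (n + 1) v)) :
    ¬ Tendsto (fun n => f n (base H)) atTop (𝓝 0) := by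
  intro h0
  have := Fintype.ofFinite (Vertex H)
  have h1 : ∀ v, Tendsto (fun n => f n v) atTop (𝓝 0) := by
    -- The Harnack inequality carries convergence to 0 across each edge.
    refine vertex_induction h0 fun v l hv => ?_
    rw [← tendsto_add_atTop_iff_nat 2]
    refine squeeze_zero (fun n => hf _ _) (fun n => h n v l) ?_
    have := (((tendsto_add_atTop_iff_nat 3).2 hv).add
      ((tendsto_add_atTop_iff_nat 1).2 hv)).const_mul C
    simpa using this
  have h2 : Tendsto (fun n => ∑ v, f (n + 1) v) atTop (𝓝 0) := by
    simpa using tendsto_finsetSum Finset.univ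
      fun v _ => (tendsto_add_atTop_iff_nat 1).2 (h1 v)
  have h3 : ∀ n, ∑ v, f (n + 1) v = m := fun n =>
    (tsum_fintype _).symm.trans (hmass n)
  simp only [h3] at h2
  exact hm (tendsto_nhds_unique tendsto_const_nhds h2)

theorem infinite_vertex_iff : Infinite (Vertex H) ↔ ¬ H.FiniteIndex := by
  rw [Subgroup.finiteIndex_iff_finite_quotient, ← not_finite_iff_infinite,
    (QuotientGroup.quotientRightRelEquivQuotientLeftRel H).finite_iff]

variable [Fintype A]

theorem tsum_wordSum_div (hA : 0 < Fintype.card A) (n : ℕ) :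
    ∑' v, wordSum (baseIndicator H) n v / (2 * Fintype.card A : ℝ) ^ n = 1 := by
  have : (0 : ℝ) < Fintype.card A := by exact_mod_cast hA
  rw [tsum_div_const, tsum_wordSum finite_support_baseIndicator, tsum_baseIndicator]
  field_simp

theorem tendsto_numWords_div (hA : 0 < Fintype.card A) (hH : ¬ H.FiniteIndex) :
    Tendsto (fun n => (numWords H n : ℝ) / (2 * Fintype.card A : ℝ) ^ n) atTop (𝓝 0) := by
  have := infinite_vertex_iff.2 hH
  simp only [numWords_eq]
  refine tendsto_base_of_infinite
    (f := fun n v => wordSum (baseIndicator H) n v / (2 * Fintype.card A : ℝ) ^ n)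
    (fun n v => div_nonneg (wordSum_nonneg baseIndicator_nonneg _ _) (by positivity)) (C := 1)
    (fun n S => ?_) fun v l => tendsto_wordSum_step_sub finite_support_baseIndicator hA v l
  rw [← tsum_wordSum_div (H := H) hA n]
  refine Summable.sum_le_tsum S
    (fun v _ => div_nonneg (wordSum_nonneg baseIndicator_nonneg _ _) (by positivity)) ?_
  exact (summable_of_hasFiniteSupport
    (finite_support_wordSum finite_support_baseIndicator n)).div_const _

theorem not_tendsto_numWords_div (hA : 0 < Fintype.card A) (hH : H.FiniteIndex) :
    ¬ Tendsto (fun n => (numWords H n : ℝ) / (2 * Fintype.card A : ℝ) ^ n) atTop (𝓝 0) := by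
  have hA' : (0 : ℝ) < Fintype.card A := by exact_mod_cast hA
  have : Finite (Vertex H) := by
    by_contra h
    exact infinite_vertex_iff.1 (not_finite_iff_infinite.1 h) hH
  simp only [numWords_eq]
  have hnn : ∀ n (v : Vertex H),
      0 ≤ wordSum (baseIndicator H) n v / (2 * Fintype.card A : ℝ) ^ n := fun n v =>
    div_nonneg (wordSum_nonneg baseIndicator_nonneg _ _) (by positivity)
  refine not_tendsto_base_of_finite
    (f := fun n v => wordSum (baseIndicator H) n v / (2 * Fintype.card A : ℝ) ^ n)
    hnn one_ne_zero (fun n => tsum_wordSum_div hA (n + 1)) (C := 2 * Fintype.card A)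
    fun n v l => ?_
  have h1 : wordSum (baseIndicator H) (n + 2) (step v l) ≤ wordSum (baseIndicator H) (n + 3) v := by
    rw [wordSum_succ _ (n + 2), adj]
    exact Finset.single_le_sum (f := fun l => wordSum (baseIndicator H) (n + 2) (step v l))
      (fun m _ => wordSum_nonneg baseIndicator_nonneg _ _) (Finset.mem_univ l)
  have h2 := hnn (n + 1) v
  calc wordSum (baseIndicator H) (n + 2) (step v l) / (2 * Fintype.card A : ℝ) ^ (n + 2)
      ≤ wordSum (baseIndicator H) (n + 3) v / (2 * Fintype.card A : ℝ) ^ (n + 2) := by gcongr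
    _ = 2 * Fintype.card A * (wordSum (baseIndicator H) (n + 3) v /
          (2 * Fintype.card A : ℝ) ^ (n + 3)) := by
        rw [pow_succ _ (n + 2)]; field_simp
    _ ≤ _ := by gcongr; linarith

variable [DecidableEq A]

/-- The mass is constant only from length 1 on: at length 0 it is 1, which is why the index is
shifted. -/
theorem tsum_sphereSum_div (hA : 1 < Fintype.card A) (n : ℕ) :
    ∑' v, sphereSum (baseIndicator H) (n + 1) v / (2 * Fintype.card A - 1 : ℝ) ^ (n + 1) =
      2 * Fintype.card A / (2 * Fintype.card A - 1) := by
  have hA' : (1 : ℝ) < Fintype.card A := by exact_mod_cast hA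
  have : (0 : ℝ) < 2 * Fintype.card A - 1 := by linarith
  rw [tsum_div_const, tsum_sphereSum finite_support_baseIndicator, tsum_baseIndicator]
  field_simp
  ring

theorem tendsto_numReducedWords_div (hA : 1 < Fintype.card A) (hH : ¬ H.FiniteIndex) :
    Tendsto (fun n => (numReducedWords H n : ℝ) / (2 * Fintype.card A - 1 : ℝ) ^ n)
      atTop (𝓝 0) := by
  have := infinite_vertex_iff.2 hH
  have hA' : (1 : ℝ) < Fintype.card A := by exact_mod_cast hA
  have hq : (0 : ℝ) < 2 * Fintype.card A - 1 := by linarith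
  have hnn : ∀ n (v : Vertex H),
      0 ≤ sphereSum (baseIndicator H) n v / (2 * Fintype.card A - 1 : ℝ) ^ n := fun n v =>
    div_nonneg (sphereSum_nonneg baseIndicator_nonneg _ _) (by positivity)
  simp only [numReducedWords_eq]
  rw [← tendsto_add_atTop_iff_nat 1]
  refine tendsto_base_of_infinite (f := fun n v =>
      sphereSum (baseIndicator H) (n + 1) v / (2 * Fintype.card A - 1 : ℝ) ^ (n + 1))
    (fun n v => hnn _ _) (C := 2 * Fintype.card A / (2 * Fintype.card A - 1))
    (fun n S => ?_) fun v l =>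
      (tendsto_add_atTop_iff_nat 1).2 (tendsto_sphereSum_step_sub finite_support_baseIndicator
        hA v l rfl)
  rw [← tsum_sphereSum_div (H := H) hA n]
  refine Summable.sum_le_tsum S (fun v _ => hnn _ _) ?_
  exact (summable_of_hasFiniteSupport
    (finite_support_sphereSum finite_support_baseIndicator (n + 1))).div_const _

theorem not_tendsto_numReducedWords_div (hA : 1 < Fintype.card A) (hH : H.FiniteIndex) :
    ¬ Tendsto (fun n => (numReducedWords H n : ℝ) / (2 * Fintype.card A - 1 : ℝ) ^ n)
      atTop (𝓝 0) := by
  have hA' : (1 : ℝ) < Fintype.card A := by exact_mod_cast hA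
  have : Finite (Vertex H) := by
    by_contra h
    exact infinite_vertex_iff.1 (not_finite_iff_infinite.1 h) hH
  obtain ⟨q, hq⟩ : ∃ q : ℝ, q = 2 * Fintype.card A - 1 := ⟨_, rfl⟩
  have hq1 : 1 < q := by linarith
  simp only [numReducedWords_eq, ← hq]
  have hnn : ∀ n (v : Vertex H), 0 ≤ sphereSum (baseIndicator H) n v / q ^ n := fun n v =>
    div_nonneg (sphereSum_nonneg baseIndicator_nonneg _ _) (by positivity)
  refine not_tendsto_base_of_finite (f := fun n v => sphereSum (baseIndicator H) n v / q ^ n)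
    hnn (m := 2 * Fintype.card A / (2 * Fintype.card A - 1)) (by rw [← hq]; positivity)
    (fun n => by rw [hq]; exact tsum_sphereSum_div hA n) (C := q) fun n v l => ?_
  -- One neighbour's value is at most the sum over all neighbours, which the recurrence computes.
  have h1 : sphereSum (baseIndicator H) (n + 2) (step v l) ≤
      sphereSum (baseIndicator H) (n + 3) v + q * sphereSum (baseIndicator H) (n + 1) v := by
    rw [hq, ← adj_sphereSum_add_two, adj]
    exact Finset.single_le_sum (f := fun l => sphereSum (baseIndicator H) (n + 2) (step v l))
      (fun m _ => sphereSum_nonneg baseIndicator_nonneg _ _) (Finset.mem_univ l)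
  have h2 := hnn (n + 1) v
  calc sphereSum (baseIndicator H) (n + 2) (step v l) / q ^ (n + 2)
      ≤ (sphereSum (baseIndicator H) (n + 3) v + q * sphereSum (baseIndicator H) (n + 1) v) /
          q ^ (n + 2) := by gcongr
    _ = q * (sphereSum (baseIndicator H) (n + 3) v / q ^ (n + 3)) +
          sphereSum (baseIndicator H) (n + 1) v / q ^ (n + 1) := by
        field_simp
        ring
    _ ≤ _ := by nlinarith

/-- The number of all reduced words of positive length. -/
theorem numReducedWords_top_succ (n : ℕ) :
    (numReducedWords (⊤ : Subgroup (FreeGroup A)) (n + 1) : ℝ) =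
      2 * Fintype.card A * (2 * Fintype.card A - 1) ^ n := by
  -- For the whole group the graph has one vertex, so the total mass is the value at the base.
  have hsub : ∀ v : Vertex (⊤ : Subgroup (FreeGroup A)), v = base ⊤ := by
    intro v
    obtain ⟨w, rfl⟩ := exists_eq_mulRight_base v
    exact (mulRight_base_eq_base_iff _).2 (Subgroup.mem_top _)
  have h := tsum_sphereSum (finite_support_baseIndicator (H := (⊤ : Subgroup (FreeGroup A)))) n
  rw [tsum_baseIndicator, mul_one, tsum_eq_single (base ⊤) fun v hv => absurd (hsub v) hv] at h
  rw [numReducedWords_eq, h]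

omit [DecidableEq A] in
/-- The number of all words. -/
theorem numWords_top (n : ℕ) :
    (numWords (⊤ : Subgroup (FreeGroup A)) n : ℝ) = (2 * Fintype.card A) ^ n := by
  have hsub : ∀ v : Vertex (⊤ : Subgroup (FreeGroup A)), v = base ⊤ := by
    intro v
    obtain ⟨w, rfl⟩ := exists_eq_mulRight_base v
    exact (mulRight_base_eq_base_iff _).2 (Subgroup.mem_top _)
  have h := tsum_wordSum (finite_support_baseIndicator (H := (⊤ : Subgroup (FreeGroup A)))) n
  rw [tsum_baseIndicator, mul_one, tsum_eq_single (base ⊤) fun v hv => absurd (hsub v) hv] at h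
  rw [numWords_eq, h]

omit [DecidableEq A] in
theorem numWords_mono {K : Subgroup (FreeGroup A)} (h : H ≤ K) (n : ℕ) :
    numWords H n ≤ numWords K n :=
  Set.ncard_le_ncard (fun _ hw => ⟨h hw.1, hw.2⟩)
    ((List.finite_length_eq _ n).subset fun _ hw => hw.2)

omit [DecidableEq A] in
theorem numReducedWords_mono {K : Subgroup (FreeGroup A)} (h : H ≤ K) (n : ℕ) :
    numReducedWords H n ≤ numReducedWords K n :=
  Set.ncard_le_ncard (fun _ hw => ⟨h hw.1, hw.2⟩)
    ((List.finite_length_eq _ n).subset fun _ hw => hw.2.2)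

omit [DecidableEq A] in
theorem numWords_le (n : ℕ) : (numWords H n : ℝ) ≤ (2 * Fintype.card A) ^ n := by
  rw [← numWords_top]
  exact_mod_cast numWords_mono le_top n

theorem numReducedWords_succ_le (n : ℕ) :
    (numReducedWords H (n + 1) : ℝ) ≤ 2 * Fintype.card A * (2 * Fintype.card A - 1) ^ n := by
  rw [← numReducedWords_top_succ]
  exact_mod_cast numReducedWords_mono le_top (n + 1)

theorem numReducedWords_zero : numReducedWords H 0 = 1 := by
  have h := numReducedWords_eq (H := H) 0
  rw [sphereSum_zero, baseIndicator, if_pos rfl] at h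
  exact_mod_cast h

end CosetGraph

/-! ### The Green function and exponential decay. -/

namespace CosetGraph

variable {A : Type*} {H : Subgroup (FreeGroup A)} [Fintype A]

theorem adj_mono {f g : Vertex H → ℝ} (h : ∀ v, f v ≤ g v) (v : Vertex H) : adj f v ≤ adj g v :=
  Finset.sum_le_sum fun _ _ => h _

theorem wordSum_mono {f g : Vertex H → ℝ} (h : ∀ v, f v ≤ g v) (n : ℕ) (v : Vertex H) :
    wordSum f n v ≤ wordSum g n v := by
  induction n generalizing v with
  | zero => exact h v
  | succ n ih => simp only [wordSum_succ]; exact adj_mono ih v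

theorem wordSum_adj (f : Vertex H → ℝ) (n : ℕ) : wordSum (adj f) n = wordSum f (n + 1) := rfl

theorem wordSum_wordSum (f : Vertex H → ℝ) (m n : ℕ) :
    wordSum (wordSum f n) m = wordSum f (m + n) :=
  (Function.iterate_add_apply adj m n f).symm

theorem adj_add_smul (f g : Vertex H → ℝ) (c : ℝ) (v : Vertex H) :
    adj (fun u => f u + c * g u) v = adj f v + c * adj g v := by
  simp only [adj, Finset.sum_add_distrib, Finset.mul_sum]

theorem wordSum_add_smul (f g : Vertex H → ℝ) (c : ℝ) (n : ℕ) (v : Vertex H) :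
    wordSum (fun u => f u + c * g u) n v = wordSum f n v + c * wordSum g n v := by
  induction n generalizing v with
  | zero => rfl
  | succ n ih =>
    simp only [wordSum_succ, ← adj_add_smul]
    exact congrArg (fun φ => adj φ v) (funext ih)

/-- The Green function of the coset graph at the base vertex, applied to `f`. -/
noncomputable def green (t : ℝ) (f : Vertex H → ℝ) : ℝ :=
  ∑' m : ℕ, t ^ m * wordSum f m (base H)

theorem green_nonneg {t : ℝ} (ht : 0 ≤ t) {f : Vertex H → ℝ} (hf : ∀ v, 0 ≤ f v) :
    0 ≤ green t f :=
  tsum_nonneg fun m => mul_nonneg (pow_nonneg ht m) (wordSum_nonneg hf m _)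

theorem green_eq {t : ℝ} {f : Vertex H → ℝ}
    (hf : Summable fun m : ℕ => t ^ m * wordSum f m (base H)) :
    green t f = f (base H) + t * green t (adj f) := by
  rw [green, hf.tsum_eq_zero_add, green, ← tsum_mul_left]
  simp only [pow_zero, one_mul, wordSum_zero, wordSum_adj]
  congr 1
  refine tsum_congr fun m => ?_
  ring

theorem green_add_smul {t c : ℝ} {f g : Vertex H → ℝ}
    (hf : Summable fun m : ℕ => t ^ m * wordSum f m (base H))
    (hg : Summable fun m : ℕ => t ^ m * wordSum g m (base H)) :
    green t (fun u => f u + c * g u) = green t f + c * green t g := by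
  rw [green, green, green, ← tsum_mul_left, ← hf.tsum_add (hg.mul_left c)]
  refine tsum_congr fun m => ?_
  rw [wordSum_add_smul]
  ring

variable [DecidableEq A]

theorem sphereSum_le_wordSum {f : Vertex H → ℝ} (hf : ∀ v, 0 ≤ f v) :
    ∀ (n : ℕ) (v : Vertex H), sphereSum f n v ≤ wordSum f n v
  | 0, _ => le_rfl
  | 1, _ => le_rfl
  | 2, v => by
    have h := adj_sphereSum_one f v
    have h2 : 0 ≤ 2 * Fintype.card A * f v := mul_nonneg (by positivity) (hf v)
    have h3 : adj (sphereSum f 1) v = wordSum f 2 v := rfl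
    linarith
  | n + 3, v => by
    have h := adj_sphereSum_add_two f n v
    have h2 : 0 ≤ (2 * Fintype.card A - 1) * sphereSum f (n + 1) v := by
      -- For an empty alphabet the coefficient is -1, but the sphere sum is then an empty sum.
      rcases isEmpty_or_nonempty A with hA | hA
      · have : sphereSum f (n + 1) v = 0 := by simp [sphereSum]
        simp [this]
      · have : (1 : ℝ) ≤ Fintype.card A := by exact_mod_cast Fintype.card_pos
        exact mul_nonneg (by linarith) (sphereSum_nonneg hf _ _)
    have h3 := adj_mono (sphereSum_le_wordSum hf (n + 2)) v
    rw [← wordSum_succ] at h3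
    linarith

/-- Since reduced words are among all words, the series is dominated by a shifted tail of the Green
series, up to the factor t^(-n). -/
theorem summable_green_sphereSum {t : ℝ} (ht : 0 < t)
    (hs : Summable fun m : ℕ => t ^ m * (numWords H m : ℝ)) (n : ℕ) :
    Summable fun m : ℕ => t ^ m * wordSum (sphereSum (baseIndicator H) n) m (base H) := by
  have h1 := ((summable_nat_add_iff n).2 hs).mul_left (t ^ n)⁻¹
  refine Summable.of_nonneg_of_le (fun m => mul_nonneg (pow_nonneg ht.le m)
    (wordSum_nonneg (sphereSum_nonneg baseIndicator_nonneg n) m _)) (fun m => ?_) h1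
  have h2 := wordSum_mono (sphereSum_le_wordSum (H := H) baseIndicator_nonneg n) m (base H)
  rw [wordSum_wordSum, ← numWords_eq] at h2
  calc _ ≤ t ^ m * (numWords H (m + n) : ℝ) := by gcongr
    _ = _ := by rw [pow_add]; field_simp

/-- If the Green function converges beyond the radius `1 / (2 k)`, then reduced words of length `n`
represent elements of `H` with exponentially small probability. -/
theorem numReducedWords_le_of_summable (hA : 1 < Fintype.card A) {z : ℝ} (hz : 1 < z)
    (hs : Summable fun m : ℕ => (z / (2 * Fintype.card A)) ^ m * (numWords H m : ℝ)) :
    ∃ C : ℝ, 0 < C ∧ ∀ n : ℕ, (numReducedWords H (n + 1) : ℝ) ≤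
      C * ((2 * Fintype.card A - 1) / z) ^ n := by
  have hA' : (1 : ℝ) < Fintype.card A := by exact_mod_cast hA
  obtain ⟨q, hq⟩ : ∃ q : ℝ, q = 2 * Fintype.card A - 1 := ⟨_, rfl⟩
  have hq1 : 1 < q := by linarith
  have hd : (2 * Fintype.card A : ℝ) = q + 1 := by linarith
  rw [← hq]
  rw [hd] at hs
  set t : ℝ := z / (q + 1) with ht
  have ht0 : 0 < t := by positivity
  set c : ℕ → ℝ := fun n => green t (sphereSum (baseIndicator H) n) with hc
  have hsum := summable_green_sphereSum ht0 hs
  have hnn : ∀ n, 0 ≤ c n := fun n =>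
    green_nonneg ht0.le (sphereSum_nonneg baseIndicator_nonneg n)
  have hbase : ∀ n, 0 ≤ sphereSum (baseIndicator H) n (base H) := fun n =>
    sphereSum_nonneg baseIndicator_nonneg n _
  have e0 : t * c 1 ≤ c 0 := by
    have h := green_eq (hsum 0)
    have h' := hbase 0
    have h1 : adj (sphereSum (baseIndicator H) 0) = sphereSum (baseIndicator H) 1 := rfl
    rw [h1] at h
    simp only [hc]
    linarith
  have e1 : t * (c 2 + (q + 1) * c 0) ≤ c 1 := by
    have h := green_eq (hsum 1)
    have h' := hbase 1
    have h1 : adj (sphereSum (baseIndicator H) 1) = fun v =>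
        sphereSum (baseIndicator H) 2 v + (q + 1) * sphereSum (baseIndicator H) 0 v := by
      ext v
      rw [adj_sphereSum_one, hd, sphereSum_zero]
    rw [h1, green_add_smul (hsum 2) (hsum 0)] at h
    simp only [hc]
    linarith
  have e2 : ∀ n, t * (c (n + 3) + q * c (n + 1)) ≤ c (n + 2) := by
    intro n
    have h := green_eq (hsum (n + 2))
    have h' := hbase (n + 2)
    have h1 : adj (sphereSum (baseIndicator H) (n + 2)) = fun v =>
        sphereSum (baseIndicator H) (n + 3) v + q * sphereSum (baseIndicator H) (n + 1) v := by
      ext v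
      rw [adj_sphereSum_add_two, hq]
    rw [h1, green_add_smul (hsum (n + 3)) (hsum (n + 1))] at h
    simp only [hc]
    linarith
  have hz0 : 0 < z := by linarith
  -- As t = z/(q + 1), the hypothesis reads z x ≤ (q + 1 - z²) y, and z² ≥ 1.
  have key : ∀ x y : ℝ, 0 ≤ y → t * x + t * z * y ≤ y → x ≤ q / z * y := by
    intro x y hy hxy
    have h1 : z * x + z * z * y ≤ (q + 1) * y := by
      have h2 := mul_le_mul_of_nonneg_left hxy (by positivity : 0 ≤ q + 1)
      have h3 : (q + 1) * (t * x + t * z * y) = z * x + z * z * y := by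
        rw [ht]; field_simp
      linarith
    rw [div_mul_eq_mul_div, le_div_iff₀ hz0]
    nlinarith [mul_nonneg (mul_nonneg (by linarith : 0 ≤ z - 1) (by linarith : 0 ≤ z + 1)) hy]
  -- The induction hypothesis z c_(n+2) ≤ q c_(n+1) bounds the backward term of the recurrence from
  -- below, which brings it to the form required by `key`. For n = 0 the inequality `e0` plays this
  -- role.
  have hstep : ∀ n, c (n + 2) ≤ q / z * c (n + 1) := by
    intro n
    induction n with
    | zero =>
      refine key _ _ (hnn 1) ?_
      have h2 : t * ((q + 1) * c 0) ≥ t * ((q + 1) * (t * c 1)) := by gcongr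
      have h3 : (q + 1) * (t * c 1) = z * c 1 := by rw [ht]; field_simp
      rw [h3] at h2
      linarith
    | succ n ih =>
      refine key _ _ (hnn (n + 2)) ?_
      have h1 : z * c (n + 2) ≤ q * c (n + 1) := by
        rw [div_mul_eq_mul_div, le_div_iff₀ hz0] at ih
        linarith
      have h2 : t * (z * c (n + 2)) ≤ t * (q * c (n + 1)) := by gcongr
      have := e2 n
      change t * c (n + 3) + t * z * c (n + 2) ≤ c (n + 2)
      linarith
  have hbound : ∀ n, c (n + 1) ≤ c 1 * (q / z) ^ n := by
    intro n
    induction n with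
    | zero => simp
    | succ n ih =>
      have h0 : 0 ≤ q / z := by positivity
      calc c (n + 2) ≤ q / z * c (n + 1) := hstep n
        _ ≤ q / z * (c 1 * (q / z) ^ n) := by gcongr
        _ = _ := by ring
  refine ⟨c 1 + 1, by linarith [hnn 1], fun n => ?_⟩
  -- The count is the term m = 0 of a series of nonnegative terms.
  have h1 : (numReducedWords H (n + 1) : ℝ) ≤ c (n + 1) := by
    have h := green_eq (hsum (n + 1))
    have h' : 0 ≤ green t (adj (sphereSum (baseIndicator H) (n + 1))) :=
      green_nonneg ht0.le (adj_nonneg (sphereSum_nonneg baseIndicator_nonneg _))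
    rw [numReducedWords_eq]
    simp only [hc]
    have := mul_nonneg ht0.le h'
    linarith
  have h0 : 0 ≤ (q / z) ^ n := by positivity
  linarith [hbound n]

end CosetGraph

/-! ### Edge-paths and their labels. -/

namespace CosetGraph

variable {A : Type*} {H : Subgroup (FreeGroup A)}

/-- The edge-path that starts at `v` and is labelled by the word `w`. -/
def pathFrom : Vertex H → List (A × Bool) → List (Vertex H × (A × Bool))
  | _, [] => []
  | v, l :: w => (v, l) :: pathFrom (step v l) w

theorem map_snd_pathFrom (v : Vertex H) (w : List (A × Bool)) :
    (pathFrom v w).map Prod.snd = w := by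
  induction w generalizing v with
  | nil => rfl
  | cons l w ih => simp [pathFrom, ih]

theorem length_pathFrom (v : Vertex H) (w : List (A × Bool)) :
    (pathFrom v w).length = w.length := by
  rw [← List.length_map Prod.snd, map_snd_pathFrom]

theorem pathFrom_injective (v : Vertex H) : Function.Injective (pathFrom v) :=
  Function.LeftInverse.injective (g := List.map Prod.snd) (map_snd_pathFrom v)

theorem isPath_pathFrom_iff (u v : Vertex H) (w : List (A × Bool)) :
    (graph H).IsPath u (pathFrom u w) v ↔ mulRight H u (FreeGroup.mk w) = v := by
  induction w generalizing u with
  | nil => rw [mulRight_mk_nil]; rfl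
  | cons l w ih =>
    rw [mulRight_mk_cons, ← ih]
    exact and_iff_right rfl

/-- A path is determined by its origin and labels, so closed paths at the base correspond to words
representing elements of H. -/
theorem eq_pathFrom_of_isPath {u v : Vertex H} {p : List (Vertex H × (A × Bool))}
    (hp : (graph H).IsPath u p v) : p = pathFrom u (p.map Prod.snd) := by
  induction p generalizing u with
  | nil => rfl
  | cons e p ih =>
    obtain ⟨x, l⟩ := e
    obtain ⟨rfl, h⟩ := hp
    exact congrArg _ (ih h)

theorem isReduced_pathFrom_iff (v : Vertex H) (w : List (A × Bool)) :
    (graph H).IsReduced (pathFrom v w) ↔ FreeGroup.IsReduced w := by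
  induction w generalizing v with
  | nil => simp [pathFrom, SerreGraph.IsReduced]
  | cons l w ih =>
    cases w with
    | nil => simp [pathFrom, SerreGraph.IsReduced]
    | cons m w =>
      rw [isReduced_cons_iff, ← ih (step v l), SerreGraph.IsReduced, SerreGraph.IsReduced]
      simp only [pathFrom, List.isChain_cons_cons, List.head?_cons, ne_eq, Option.some.injEq]
      refine and_congr_left fun _ => not_congr ?_
      change (step v l, m) = (step v l, invLetter l) ↔ _
      simp

theorem numClosedPaths_eq (n : ℕ) :
    (graph H).numClosedPaths (base H) n = numWords H n := by
  rw [numWords, ← Set.ncard_image_of_injective _ (pathFrom_injective (base H))]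
  refine congrArg Set.ncard (Set.ext fun p => ⟨fun hp => ?_, ?_⟩)
  · have h := eq_pathFrom_of_isPath hp.1
    refine ⟨p.map Prod.snd, ⟨?_, by rw [List.length_map]; exact hp.2⟩, h.symm⟩
    have h1 := hp.1
    rw [h, isPath_pathFrom_iff] at h1
    exact (mulRight_base_eq_base_iff _).1 h1
  · rintro ⟨w, hw, rfl⟩
    exact ⟨(isPath_pathFrom_iff _ _ _).2 ((mulRight_base_eq_base_iff _).2 hw.1),
      (length_pathFrom _ _).trans hw.2⟩

theorem numReducedClosedPaths_eq (n : ℕ) :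
    (graph H).numReducedClosedPaths (base H) n = numReducedWords H n := by
  rw [numReducedWords, ← Set.ncard_image_of_injective _ (pathFrom_injective (base H))]
  refine congrArg Set.ncard (Set.ext fun p => ⟨fun hp => ?_, ?_⟩)
  · have h := eq_pathFrom_of_isPath hp.1
    have h1 := hp.1
    have h2 := hp.2.1
    rw [h, isPath_pathFrom_iff] at h1
    rw [h, isReduced_pathFrom_iff] at h2
    exact ⟨p.map Prod.snd, ⟨(mulRight_base_eq_base_iff _).1 h1, h2,
      by rw [List.length_map]; exact hp.2.2⟩, h.symm⟩
  · rintro ⟨w, hw, rfl⟩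
    exact ⟨(isPath_pathFrom_iff _ _ _).2 ((mulRight_base_eq_base_iff _).2 hw.1),
      (isReduced_pathFrom_iff _ _).2 hw.2.1, (length_pathFrom _ _).trans hw.2.2⟩

theorem isRegular_graph [Fintype A] : (graph H).IsRegular (2 * Fintype.card A) := by
  intro v
  have h : {e : Vertex H × (A × Bool) | (graph H).o e = v} = Set.range (Prod.mk v) := by
    ext ⟨u, l⟩
    change u = v ↔ _
    simp [eq_comm]
  rw [h, ← Set.image_univ, (Prod.mk_right_injective v).encard_image, Set.encard_univ,
    ENat.card_eq_coe_fintype_card, Fintype.card_prod, Fintype.card_bool, mul_comm]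

end CosetGraph

/-! ### Real sequences: partial sums, limsups and roots. -/

section Sequences

theorem TendsToZeroExpFast.of_le {s : ℕ → ℝ} (h0 : ∀ n, 0 ≤ s n) {σ C : ℝ} (hσ : 0 ≤ σ)
    (hσ1 : σ < 1) (hs : ∀ n, s n ≤ C * σ ^ n) : TendsToZeroExpFast s := by
  have hC : 0 ≤ C := (h0 0).trans (by simpa using hs 0)
  -- The constant C may vanish, and a positive one is required.
  refine ⟨h0, squeeze_zero h0 hs ?_, σ, C + 1, hσ, hσ1, by linarith, fun n _ => ?_⟩
  · simpa using (tendsto_pow_atTop_nhds_zero_of_lt_one hσ hσ1).const_mul C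
  · have : 0 ≤ σ ^ n := pow_nonneg hσ n
    linarith [hs n]

theorem TendsToZeroExpFast.mono {s s' : ℕ → ℝ} (h : TendsToZeroExpFast s') (h0 : ∀ n, 0 ≤ s n)
    (hs : ∀ n, s n ≤ s' n) : TendsToZeroExpFast s := by
  obtain ⟨_, h2, σ, C, h3, h4, h5, h6⟩ := h
  exact ⟨h0, squeeze_zero h0 hs h2, σ, C, h3, h4, h5, fun n hn => (hs n).trans (h6 n hn)⟩

theorem partial_sums_le_of_le {x y : ℕ → ℝ} (h0 : y 0 = x 0)
    (h1 : ∀ n, y (n + 1) = y n + x (n + 1)) {θ C : ℝ} (hθ : 1 < θ) (hC : 0 ≤ C)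
    (hx : ∀ n, x n ≤ C * θ ^ n) (n : ℕ) : y n ≤ C * θ / (θ - 1) * θ ^ n := by
  have hθ' : 0 < θ - 1 := by linarith
  induction n with
  | zero =>
    have h := hx 0
    simp only [pow_zero, mul_one] at h ⊢
    rw [h0, le_div_iff₀ hθ']
    nlinarith
  | succ n ih =>
    rw [h1]
    calc y n + x (n + 1) ≤ C * θ / (θ - 1) * θ ^ n + C * θ ^ (n + 1) := add_le_add ih (hx _)
      _ = _ := by rw [pow_succ]; field_simp; ring

theorem TendsToZeroExpFast.partial_sums {x y : ℕ → ℝ} (hx0 : ∀ n, 0 ≤ x n) (h0 : y 0 = x 0)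
    (h1 : ∀ n, y (n + 1) = y n + x (n + 1)) {θ : ℝ} (hθ : 1 < θ)
    (h : TendsToZeroExpFast fun n => x n / θ ^ n) : TendsToZeroExpFast fun n => y n / θ ^ n := by
  have hθ0 : 0 < θ := by linarith
  have hy0 : ∀ n, 0 ≤ y n := by
    intro n
    induction n with
    | zero => rw [h0]; exact hx0 0
    | succ n ih => rw [h1]; exact add_nonneg ih (hx0 _)
  obtain ⟨-, -, σ, C, h3, h4, h5, h6⟩ := h
  -- The rate is raised until τθ > 1, so that the sums of (τθ)^n are bounded by a multiple of their
  -- last term.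
  obtain ⟨τ, hτσ, hτ, hτ1⟩ : ∃ τ, σ ≤ τ ∧ 1 < τ * θ ∧ τ < 1 := by
    refine ⟨max σ ((1 + θ⁻¹) / 2), le_max_left _ _, ?_, max_lt h4 ?_⟩
    · have h7 : (1 + θ⁻¹) / 2 * θ = (θ + 1) / 2 := by field_simp
      have h8 : (1 + θ⁻¹) / 2 * θ ≤ max σ ((1 + θ⁻¹) / 2) * θ := by
        gcongr; exact le_max_right _ _
      linarith
    · have := inv_lt_one_of_one_lt₀ hθ
      linarith
  have hτ0 : 0 ≤ τ := h3.trans hτσ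
  -- The summand x 0 covers n = 0, where the exponential bound is not assumed.
  have hx : ∀ n, x n ≤ (C + x 0) * (τ * θ) ^ n := by
    intro n
    have hp : 0 ≤ (τ * θ) ^ n := by positivity
    rcases Nat.eq_zero_or_pos n with rfl | hn
    · simp only [pow_zero]; linarith
    · have h7 := h6 n hn
      rw [div_le_iff₀ (by positivity)] at h7
      have h8 : C * σ ^ n * θ ^ n ≤ C * τ ^ n * θ ^ n := by gcongr
      have h9 := mul_nonneg (hx0 0) hp
      rw [mul_pow] at h9 ⊢
      linarith
  refine .of_le (fun n => div_nonneg (hy0 n) (by positivity)) hτ0 hτ1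
    (C := (C + x 0) * (τ * θ) / (τ * θ - 1)) fun n => ?_
  have h7 := partial_sums_le_of_le h0 h1 hτ (by linarith [hx0 0]) hx n
  rw [div_le_iff₀ (by positivity), mul_assoc, ← mul_pow]
  exact h7

theorem tendsto_zero_of_linear_recurrence {u y : ℕ → ℝ} {ρ : ℝ} (hρ : 0 ≤ ρ) (hρ1 : ρ < 1)
    (hy : ∀ n, 0 ≤ y n) (h : ∀ n, y (n + 1) = ρ * y n + u n) (hu : Tendsto u atTop (𝓝 0)) :
    Tendsto y atTop (𝓝 0) := by
  have hρ' : 0 < 1 - ρ := by linarith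
  rw [Metric.tendsto_atTop]
  intro ε hε
  -- With this threshold ε/2 is the fixed point of y ↦ ρy + ε/2 (1 - ρ).
  obtain ⟨N, hN⟩ := Metric.tendsto_atTop.1 hu (ε / 2 * (1 - ρ)) (by positivity)
  have h1 : ∀ i, y (N + i) ≤ ρ ^ i * y N + ε / 2 := by
    intro i
    induction i with
    | zero => simp; linarith
    | succ i ih =>
      have h2 := hN (N + i) (by omega)
      rw [Real.dist_0_eq_abs, abs_lt] at h2
      have h3 : ρ * y (N + i) ≤ ρ * (ρ ^ i * y N + ε / 2) := by gcongr
      rw [← add_assoc, h, pow_succ]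
      linarith [h2.2]
  have h2 : Tendsto (fun i => ρ ^ i * y N) atTop (𝓝 0) := by
    simpa using (tendsto_pow_atTop_nhds_zero_of_lt_one hρ hρ1).mul_const (y N)
  obtain ⟨M, hM⟩ := (h2.eventually (gt_mem_nhds (half_pos hε))).exists_forall_of_atTop
  refine ⟨N + M, fun n hn => ?_⟩
  obtain ⟨i, rfl⟩ := Nat.exists_eq_add_of_le ((Nat.le_add_right N M).trans hn)
  rw [Real.dist_0_eq_abs, abs_of_nonneg (hy _)]
  linarith [h1 i, hM i (by omega)]

theorem tendsto_partial_sums_div {x y : ℕ → ℝ} (hx0 : ∀ n, 0 ≤ x n) (h0 : y 0 = x 0)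
    (h1 : ∀ n, y (n + 1) = y n + x (n + 1)) {θ : ℝ} (hθ : 1 < θ)
    (h : Tendsto (fun n => x n / θ ^ n) atTop (𝓝 0)) :
    Tendsto (fun n => y n / θ ^ n) atTop (𝓝 0) := by
  have hθ0 : 0 < θ := by linarith
  have hy0 : ∀ n, 0 ≤ y n := by
    intro n
    induction n with
    | zero => rw [h0]; exact hx0 0
    | succ n ih => rw [h1]; exact add_nonneg ih (hx0 _)
  refine tendsto_zero_of_linear_recurrence (ρ := θ⁻¹) (by positivity)
    (inv_lt_one_of_one_lt₀ hθ) (fun n => div_nonneg (hy0 n) (by positivity)) (fun n => ?_)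
    ((tendsto_add_atTop_iff_nat 1).2 h)
  rw [h1, pow_succ]
  field_simp

/-- The upper bound matters: the real limsup of a sequence unbounded above takes the default value
0. -/
theorem limsup_pos_of_not_tendsto {u : ℕ → ℝ} (h0 : ∀ n, 0 ≤ u n) {C : ℝ} (hC : ∀ n, u n ≤ C)
    (h : ¬ Tendsto u atTop (𝓝 0)) : 0 < limsup u atTop := by
  by_contra! hle
  refine h (Metric.tendsto_atTop.2 fun ε hε => ?_)
  have hb : IsBoundedUnder (· ≤ ·) atTop u := isBoundedUnder_of ⟨C, hC⟩
  obtain ⟨N, hN⟩ := (eventually_lt_of_limsup_lt (hle.trans_lt hε) hb).exists_forall_of_atTop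
  refine ⟨N, fun n hn => ?_⟩
  rw [Real.dist_0_eq_abs, abs_of_nonneg (h0 n)]
  exact hN n hn

theorem limsup_root_le {u : ℕ → ℕ} {q C : ℝ} (hq : 0 < q)
    (hu : ∀ n, (u n : ℝ) ≤ C * q ^ n) :
    limsup (fun n : ℕ => (u n : ℝ≥0∞) ^ (1 / (n : ℝ))) atTop ≤ ENNReal.ofReal q := by
  have hC : 0 ≤ C := (Nat.cast_nonneg (u 0)).trans (by simpa using hu 0)
  -- The base C + 1 is positive, so its n-th roots tend to 1 even when C = 0.
  have h1 : Tendsto (fun n : ℕ => ENNReal.ofReal ((C + 1) ^ (1 / (n : ℝ)) * q)) atTop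
      (𝓝 (ENNReal.ofReal q)) := by
    refine ENNReal.tendsto_ofReal ?_
    have h2 : Tendsto (fun n : ℕ => (C + 1) ^ (1 / (n : ℝ))) atTop (𝓝 ((C + 1) ^ (0 : ℝ))) :=
      (Real.continuousAt_const_rpow (by linarith)).tendsto.comp
        tendsto_one_div_atTop_nhds_zero_nat
    simpa using h2.mul_const q
  rw [← h1.limsup_eq]
  refine limsup_le_limsup ?_
  filter_upwards [eventually_ge_atTop 1] with n hn
  have hn' : (n : ℝ) ≠ 0 := by exact_mod_cast (by omega : n ≠ 0)
  have hle : (u n : ℝ) ≤ ((C + 1) ^ (1 / (n : ℝ)) * q) ^ n := by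
    rw [mul_pow, ← Real.rpow_natCast, ← Real.rpow_mul (by linarith), one_div,
      inv_mul_cancel₀ hn', Real.rpow_one]
    have : 0 ≤ q ^ n := by positivity
    linarith [hu n]
  have h3 : (u n : ℝ≥0∞) ≤ ENNReal.ofReal ((C + 1) ^ (1 / (n : ℝ)) * q) ^ (n : ℝ) := by
    rw [ENNReal.rpow_natCast, ← ENNReal.ofReal_pow (by positivity), ← ENNReal.ofReal_natCast]
    exact ENNReal.ofReal_le_ofReal hle
  rw [one_div] at h3 ⊢
  exact (ENNReal.rpow_inv_le_iff (by positivity)).2 h3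

end Sequences

/-! ### Cumulative counts, densities and cogrowth rates. -/

namespace CosetGraph

section CumulativeCounts

variable {A : Type*} {H : Subgroup (FreeGroup A)}

theorem numWordsLE_zero : numWordsLE H 0 = numWords H 0 := by
  simp only [numWordsLE, numWords, Nat.le_zero]

theorem numReducedWordsLE_zero : numReducedWordsLE H 0 = numReducedWords H 0 := by
  simp only [numReducedWordsLE, numReducedWords, Nat.le_zero]

theorem numWordsLE_succ [Finite A] (n : ℕ) :
    numWordsLE H (n + 1) = numWordsLE H n + numWords H (n + 1) :=
  ncard_words_le_succ (fun w => w ∈ wordsRepresenting H) n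

theorem numReducedWordsLE_succ [Finite A] (n : ℕ) :
    numReducedWordsLE H (n + 1) = numReducedWordsLE H n + numReducedWords H (n + 1) := by
  have h := ncard_words_le_succ
    (fun w => w ∈ wordsRepresenting H ∧ FreeGroup.IsReduced w) n
  simp only [and_assoc] at h
  exact h

theorem numWords_le_numWordsLE [Finite A] (n : ℕ) : numWords H n ≤ numWordsLE H n := by
  cases n with
  | zero => exact numWordsLE_zero.ge
  | succ n => rw [numWordsLE_succ]; exact Nat.le_add_left _ _

theorem numReducedWords_le_numReducedWordsLE [Finite A] (n : ℕ) :
    numReducedWords H n ≤ numReducedWordsLE H n := by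
  cases n with
  | zero => exact numReducedWordsLE_zero.ge
  | succ n => rw [numReducedWordsLE_succ]; exact Nat.le_add_left _ _

theorem wordDensity_eq (n : ℕ) :
    wordDensity (wordsRepresenting H) n =
      (numWordsLE H n : ℝ) / numWordsLE (⊤ : Subgroup (FreeGroup A)) n := by
  have h : {w : List (A × Bool) | w.length ≤ n} =
      {w | w ∈ wordsRepresenting (⊤ : Subgroup (FreeGroup A)) ∧ w.length ≤ n} := by
    ext w
    exact (and_iff_right (Subgroup.mem_top (FreeGroup.mk w))).symm
  rw [numWordsLE, numWordsLE, ← h]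
  rfl

/-- Reduced words are normal forms, so taking the reduced word of an element is a bijection. -/
theorem ncard_inter_freeBall [DecidableEq A] (n : ℕ) :
    ((H : Set (FreeGroup A)) ∩ freeBall A n).ncard = numReducedWordsLE H n := by
  rw [numReducedWordsLE, ← Set.ncard_image_of_injective ((H : Set (FreeGroup A)) ∩ freeBall A n)
    FreeGroup.toWord_injective]
  refine congrArg Set.ncard (Set.ext fun w => ⟨?_, fun hw => ?_⟩)
  · rintro ⟨g, hg, rfl⟩
    refine ⟨?_, FreeGroup.isReduced_toWord, hg.2⟩
    change FreeGroup.mk g.toWord ∈ H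
    rw [FreeGroup.mk_toWord]
    exact hg.1
  · have h : (FreeGroup.mk w).toWord = w := by
      rw [FreeGroup.toWord_mk, hw.2.1.reduce_eq]
    refine ⟨FreeGroup.mk w, ⟨hw.1, ?_⟩, h⟩
    change (FreeGroup.mk w).toWord.length ≤ n
    rw [h]
    exact hw.2.2

theorem ncard_freeBall [DecidableEq A] (n : ℕ) :
    (freeBall A n).ncard = numReducedWordsLE (⊤ : Subgroup (FreeGroup A)) n := by
  rw [← ncard_inter_freeBall, Subgroup.coe_top, Set.univ_inter]

theorem ballDensity_eq [DecidableEq A] (n : ℕ) :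
    ballDensity (H : Set (FreeGroup A)) n =
      (numReducedWordsLE H n : ℝ) / numReducedWordsLE (⊤ : Subgroup (FreeGroup A)) n := by
  rw [ballDensity, ncard_inter_freeBall, ncard_freeBall]

end CumulativeCounts

section Densities

variable {A : Type*} {H : Subgroup (FreeGroup A)} [Fintype A]

theorem wordDensity_le (hA : 0 < Fintype.card A) (n : ℕ) :
    wordDensity (wordsRepresenting H) n ≤ (numWordsLE H n : ℝ) / (2 * Fintype.card A) ^ n := by
  have hA' : (0 : ℝ) < Fintype.card A := by exact_mod_cast hA
  rw [wordDensity_eq, ← numWords_top]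
  have h : (0 : ℝ) < numWords (⊤ : Subgroup (FreeGroup A)) n := by
    rw [numWords_top]; positivity
  gcongr
  exact numWords_le_numWordsLE n

variable [DecidableEq A]

theorem pow_le_numReducedWords_top (hA : 1 < Fintype.card A) (n : ℕ) :
    (2 * Fintype.card A - 1 : ℝ) ^ n ≤ numReducedWords (⊤ : Subgroup (FreeGroup A)) n := by
  have hA' : (1 : ℝ) < Fintype.card A := by exact_mod_cast hA
  cases n with
  | zero => rw [numReducedWords_zero]; simp
  | succ n =>
    rw [numReducedWords_top_succ, pow_succ']
    have : (0 : ℝ) ≤ (2 * Fintype.card A - 1) ^ n := pow_nonneg (by linarith) n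
    nlinarith

theorem ballDensity_le (hA : 1 < Fintype.card A) (n : ℕ) :
    ballDensity (H : Set (FreeGroup A)) n ≤
      (numReducedWordsLE H n : ℝ) / (2 * Fintype.card A - 1) ^ n := by
  have hA' : (1 : ℝ) < Fintype.card A := by exact_mod_cast hA
  rw [ballDensity_eq]
  have h : (0 : ℝ) < (2 * Fintype.card A - 1) ^ n := pow_pos (by linarith) n
  refine div_le_div_of_nonneg_left (by positivity) h ((pow_le_numReducedWords_top hA n).trans ?_)
  exact_mod_cast numReducedWords_le_numReducedWordsLE n

theorem numReducedWords_le (hA : 1 < Fintype.card A) (n : ℕ) :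
    (numReducedWords H n : ℝ) ≤ 2 * (2 * Fintype.card A - 1) ^ n := by
  have hA' : (1 : ℝ) < Fintype.card A := by exact_mod_cast hA
  cases n with
  | zero => rw [numReducedWords_zero]; norm_num
  | succ n =>
    refine (numReducedWords_succ_le n).trans ?_
    rw [pow_succ']
    have : (0 : ℝ) ≤ (2 * Fintype.card A - 1) ^ n := pow_nonneg (by linarith) n
    nlinarith

theorem ncard_freeBall_eq (hA : 1 < Fintype.card A) (n : ℕ) :
    ((freeBall A n).ncard : ℝ) = 1 + (Fintype.card A : ℝ) / ((Fintype.card A : ℝ) - 1) *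
      ((2 * (Fintype.card A : ℝ) - 1) ^ n - 1) := by
  have hA' : (1 : ℝ) < Fintype.card A := by exact_mod_cast hA
  have h0 : (Fintype.card A : ℝ) - 1 ≠ 0 := by linarith
  rw [ncard_freeBall]
  induction n with
  | zero => rw [numReducedWordsLE_zero, numReducedWords_zero]; simp
  | succ n ih =>
    rw [numReducedWordsLE_succ, Nat.cast_add, ih, numReducedWords_top_succ]
    field_simp
    ring

omit [DecidableEq A] in
theorem nonReducedCogrowthRate_le (hA : 0 < Fintype.card A) :
    (graph H).nonReducedCogrowthRate (base H) ≤ ((2 * Fintype.card A : ℕ) : ℝ≥0∞) := by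
  have hA' : (0 : ℝ) < Fintype.card A := by exact_mod_cast hA
  have h := limsup_root_le (u := fun n => (graph H).numClosedPaths (base H) n)
    (q := 2 * Fintype.card A) (C := 1) (by positivity) fun n => by
      rw [numClosedPaths_eq, one_mul]; exact numWords_le n
  refine h.trans_eq ?_
  rw [← ENNReal.ofReal_natCast]
  push_cast
  rfl

theorem cogrowthRate_le (hA : 1 < Fintype.card A) :
    (graph H).cogrowthRate (base H) ≤ ((2 * Fintype.card A - 1 : ℕ) : ℝ≥0∞) := by
  have hA' : (1 : ℝ) < Fintype.card A := by exact_mod_cast hA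
  have h := limsup_root_le (u := fun n => (graph H).numReducedClosedPaths (base H) n)
    (q := 2 * Fintype.card A - 1) (C := 2) (by linarith) fun n => by
      rw [numReducedClosedPaths_eq]; exact numReducedWords_le hA n
  refine h.trans_eq ?_
  rw [← ENNReal.ofReal_natCast, Nat.cast_sub (by omega)]
  push_cast
  rfl

omit [DecidableEq A] in
/-- On a non-amenable coset graph the Green function converges beyond the radius `1 / (2 k)`. -/
theorem exists_summable_of_not_isAmenable (hA : 0 < Fintype.card A)
    (h : ¬ (graph H).IsAmenable (2 * Fintype.card A) (base H)) :
    ∃ z : ℝ, 1 < z ∧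
      Summable fun m : ℕ => (z / (2 * Fintype.card A)) ^ m * (numWords H m : ℝ) := by
  have hA' : (0 : ℝ) < Fintype.card A := by exact_mod_cast hA
  set d : ℝ := 2 * Fintype.card A with hd
  have hd0 : 0 < d := by positivity
  have hdn : ((2 * Fintype.card A : ℕ) : ℝ≥0∞) = ENNReal.ofReal d := by
    rw [← ENNReal.ofReal_natCast, hd]; push_cast; rfl
  have hlt : (graph H).nonReducedCogrowthRate (base H) < ENNReal.ofReal d := by
    rw [← hdn]
    refine lt_of_le_of_ne (nonReducedCogrowthRate_le hA) fun heq => h ?_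
    rw [SerreGraph.IsAmenable, SerreGraph.spectralRadius, heq]
    exact ENNReal.div_self (by exact_mod_cast (by omega : 2 * Fintype.card A ≠ 0))
      (ENNReal.natCast_ne_top _)
  obtain ⟨r, hr1, hr2⟩ := ENNReal.lt_iff_exists_nnreal_btwn.1 hlt
  have hr0 : (0 : ℝ) < r := by
    have : (0 : ℝ≥0∞) < r := zero_le.trans_lt hr1
    exact_mod_cast this
  have hrd : (r : ℝ) < d := by
    rw [← ENNReal.ofReal_coe_nnreal] at hr2
    exact (ENNReal.ofReal_lt_ofReal_iff hd0).1 hr2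
  have hev : ∀ᶠ m : ℕ in atTop, (numWords H m : ℝ) ≤ (r : ℝ) ^ m := by
    filter_upwards [eventually_lt_of_limsup_lt hr1, eventually_ge_atTop 1] with m hm hm1
    rw [numClosedPaths_eq, one_div] at hm
    have hm0 : (0 : ℝ) < m := by exact_mod_cast hm1
    have h1 := (ENNReal.rpow_inv_le_iff hm0).1 hm.le
    rw [ENNReal.rpow_natCast] at h1
    exact_mod_cast h1
  -- This z makes zr/d the midpoint of r/d and 1, the ratio of the dominating geometric series.
  refine ⟨(1 + d / r) / 2, ?_, ?_⟩
  · have : 1 < d / r := (one_lt_div hr0).2 hrd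
    linarith
  · have hρ : (1 + d / r) / 2 / d * r = (r / d + 1) / 2 := by field_simp
    have hρ1 : (r : ℝ) / d < 1 := (div_lt_one hd0).2 hrd
    have hg : Summable fun m : ℕ => (((r : ℝ) / d + 1) / 2) ^ m :=
      summable_geometric_of_lt_one (by positivity) (by linarith)
    refine Summable.of_norm_bounded_eventually_nat hg ?_
    filter_upwards [hev] with m hm
    rw [Real.norm_of_nonneg (by positivity), ← hρ, mul_pow]
    gcongr

omit [DecidableEq A] in
theorem numWords_expFast_of_summable (hA : 0 < Fintype.card A) {z : ℝ} (hz : 1 < z)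
    (hs : Summable fun m : ℕ => (z / (2 * Fintype.card A)) ^ m * (numWords H m : ℝ)) :
    TendsToZeroExpFast fun n => (numWords H n : ℝ) / (2 * Fintype.card A : ℝ) ^ n := by
  have hA' : (0 : ℝ) < Fintype.card A := by exact_mod_cast hA
  have hz0 : 0 < z := by linarith
  refine .of_le (fun n => by positivity) (σ := z⁻¹) (by positivity) (inv_lt_one_of_one_lt₀ hz)
    (C := ∑' m : ℕ, (z / (2 * Fintype.card A)) ^ m * (numWords H m : ℝ)) fun n => ?_
  have h := hs.le_tsum n fun m _ => by positivity
  calc (numWords H n : ℝ) / (2 * Fintype.card A : ℝ) ^ n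
      = (z / (2 * Fintype.card A)) ^ n * (numWords H n : ℝ) * z⁻¹ ^ n := by
        rw [div_pow, inv_pow]; field_simp
    _ ≤ _ := by gcongr

theorem numReducedWords_expFast_of_summable (hA : 1 < Fintype.card A) {z : ℝ} (hz : 1 < z)
    (hs : Summable fun m : ℕ => (z / (2 * Fintype.card A)) ^ m * (numWords H m : ℝ)) :
    TendsToZeroExpFast fun n => (numReducedWords H n : ℝ) / (2 * Fintype.card A - 1 : ℝ) ^ n := by
  have hA' : (1 : ℝ) < Fintype.card A := by exact_mod_cast hA
  obtain ⟨C, hC, h⟩ := numReducedWords_le_of_summable hA hz hs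
  obtain ⟨q, hq⟩ : ∃ q : ℝ, q = 2 * Fintype.card A - 1 := ⟨_, rfl⟩
  rw [← hq] at h ⊢
  have hq0 : 0 < q := by linarith
  have hz0 : 0 < z := by linarith
  have hCz : 0 ≤ C * z / q := by positivity
  refine .of_le (fun n => by positivity) (σ := z⁻¹) (by positivity) (inv_lt_one_of_one_lt₀ hz)
    (C := 1 + C * z / q) fun n => ?_
  cases n with
  | zero => rw [numReducedWords_zero]; simpa using hCz
  | succ n =>
    rw [div_le_iff₀ (by positivity)]
    calc (numReducedWords H (n + 1) : ℝ) ≤ C * (q / z) ^ n := h n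
      _ = C * z / q * z⁻¹ ^ (n + 1) * q ^ (n + 1) := by
        rw [div_pow, inv_pow, pow_succ, pow_succ]; field_simp
      _ ≤ _ := by gcongr; linarith

end Densities

end CosetGraph

/-! ### The main theorem. -/

open CosetGraph

theorem theorem6p3 (k : ℕ) (hk : 2 ≤ k) (H : Subgroup (FreeGroup (Fin k))) :
    -- the coset graph is regular of degree 2k, and the two cogrowth rates are bounded
    ((CosetGraph.graph H).IsRegular (2 * k) ∧
      (CosetGraph.graph H).cogrowthRate (CosetGraph.base H) ≤ ((2 * k - 1 : ℕ) : ℝ≥0∞) ∧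
      (CosetGraph.graph H).nonReducedCogrowthRate (CosetGraph.base H) ≤ ((2 * k : ℕ) : ℝ≥0∞)) ∧
    -- the cardinality of the balls of the free group
    (∀ n : ℕ, ((freeBall (Fin k) n).ncard : ℝ) =
      1 + (k : ℝ) / ((k : ℝ) - 1) * ((2 * (k : ℝ) - 1) ^ n - 1)) ∧
    -- infinite index
    (¬ H.FiniteIndex →
      Tendsto (fun n : ℕ => (numReducedWords H n : ℝ) / (2 * (k : ℝ) - 1) ^ n) atTop (𝓝 0) ∧
      Tendsto (fun n : ℕ => (numReducedWordsLE H n : ℝ) / (2 * (k : ℝ) - 1) ^ n) atTop (𝓝 0) ∧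
      Tendsto (fun n : ℕ => (numWords H n : ℝ) / (2 * (k : ℝ)) ^ n) atTop (𝓝 0) ∧
      Tendsto (fun n : ℕ => (numWordsLE H n : ℝ) / (2 * (k : ℝ)) ^ n) atTop (𝓝 0) ∧
      Tendsto (wordDensity (wordsRepresenting H)) atTop (𝓝 0) ∧
      Tendsto (ballDensity (H : Set (FreeGroup (Fin k)))) atTop (𝓝 0)) ∧
    -- non-amenable coset graph
    (¬ (CosetGraph.graph H).IsAmenable (2 * k) (CosetGraph.base H) →
      ¬ H.FiniteIndex ∧
      TendsToZeroExpFast (fun n : ℕ => (numReducedWords H n : ℝ) / (2 * (k : ℝ) - 1) ^ n) ∧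
      TendsToZeroExpFast (fun n : ℕ => (numReducedWordsLE H n : ℝ) / (2 * (k : ℝ) - 1) ^ n) ∧
      TendsToZeroExpFast (fun n : ℕ => (numWords H n : ℝ) / (2 * (k : ℝ)) ^ n) ∧
      TendsToZeroExpFast (fun n : ℕ => (numWordsLE H n : ℝ) / (2 * (k : ℝ)) ^ n) ∧
      TendsToZeroExpFast (wordDensity (wordsRepresenting H)) ∧
      TendsToZeroExpFast (ballDensity (H : Set (FreeGroup (Fin k))))) ∧
    -- finite index
    (H.FiniteIndex →
      0 < limsup (fun n : ℕ => (numReducedWords H n : ℝ) / (2 * (k : ℝ) - 1) ^ n) atTop ∧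
      0 < limsup (fun n : ℕ => (numReducedWordsLE H n : ℝ) / (2 * (k : ℝ) - 1) ^ n) atTop ∧
      0 < limsup (fun n : ℕ => (numWords H n : ℝ) / (2 * (k : ℝ)) ^ n) atTop ∧
      0 < limsup (fun n : ℕ => (numWordsLE H n : ℝ) / (2 * (k : ℝ)) ^ n) atTop) := by
  have hA1 : 1 < Fintype.card (Fin k) := by rw [Fintype.card_fin]; omega
  have hA0 : 0 < Fintype.card (Fin k) := by omega
  have hk' : (2 : ℝ) ≤ k := by exact_mod_cast hk
  have hq1 : (1 : ℝ) < 2 * k - 1 := by linarith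
  have hd1 : (1 : ℝ) < 2 * k := by linarith
  have hr0 : (numReducedWordsLE H 0 : ℝ) = numReducedWords H 0 := by
    rw [numReducedWordsLE_zero]
  have hr1 : ∀ n, (numReducedWordsLE H (n + 1) : ℝ) =
      numReducedWordsLE H n + numReducedWords H (n + 1) := fun n => by
    rw [numReducedWordsLE_succ]; push_cast; rfl
  have hz0 : (numWordsLE H 0 : ℝ) = numWords H 0 := by rw [numWordsLE_zero]
  have hz1 : ∀ n, (numWordsLE H (n + 1) : ℝ) = numWordsLE H n + numWords H (n + 1) := fun n => by
    rw [numWordsLE_succ]; push_cast; rfl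
  have hwd := wordDensity_le (H := H) hA0
  have hbd := ballDensity_le (H := H) hA1
  have hwd0 : ∀ n, 0 ≤ wordDensity (wordsRepresenting H) n := fun n => by
    unfold wordDensity; positivity
  have hbd0 : ∀ n, 0 ≤ ballDensity (H : Set (FreeGroup (Fin k))) n := fun n => by
    unfold ballDensity; positivity
  have hqn : ∀ n, (0 : ℝ) < (2 * k - 1) ^ n := fun n => pow_pos (by linarith) n
  have hna : ¬ (graph H).IsAmenable (2 * k) (base H) →
      TendsToZeroExpFast (fun n : ℕ => (numReducedWords H n : ℝ) / (2 * (k : ℝ) - 1) ^ n) ∧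
      TendsToZeroExpFast (fun n : ℕ => (numWords H n : ℝ) / (2 * (k : ℝ)) ^ n) := by
    intro h
    obtain ⟨z, hz, hs⟩ := exists_summable_of_not_isAmenable (H := H) hA0
      (by rwa [Fintype.card_fin])
    have ha := numReducedWords_expFast_of_summable hA1 hz hs
    have hb := numWords_expFast_of_summable hA0 hz hs
    rw [Fintype.card_fin] at ha hb
    exact ⟨ha, hb⟩
  have hreg := isRegular_graph (H := H)
  have hα := cogrowthRate_le (H := H) hA1
  have hβ := nonReducedCogrowthRate_le (H := H) hA0
  have hball := ncard_freeBall_eq hA1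
  have hinf_a := tendsto_numReducedWords_div (H := H) hA1
  have hinf_b := tendsto_numWords_div (H := H) hA0
  have hfin_a := not_tendsto_numReducedWords_div (H := H) hA1
  have hfin_b := not_tendsto_numWords_div (H := H) hA0
  have hle_a := numReducedWords_le (H := H) hA1
  have hle_b : ∀ n, (numWords H n : ℝ) ≤ 1 * (2 * Fintype.card (Fin k)) ^ n := fun n => by
    rw [one_mul]; exact numWords_le n
  rw [Fintype.card_fin] at hwd hbd hreg hα hβ hball hinf_a hinf_b hfin_a hfin_b hle_a hle_b
  refine ⟨⟨hreg, hα, hβ⟩, hball, fun hH => ?_, fun hH => ?_, fun hH => ?_⟩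
  · have hr := tendsto_partial_sums_div
      (y := fun n => (numReducedWordsLE H n : ℝ)) (fun n => Nat.cast_nonneg _) hr0 hr1 hq1 (hinf_a hH)
    have hz := tendsto_partial_sums_div
      (y := fun n => (numWordsLE H n : ℝ)) (fun n => Nat.cast_nonneg _) hz0 hz1 hd1 (hinf_b hH)
    exact ⟨hinf_a hH, hr, hinf_b hH, hz, squeeze_zero hwd0 hwd hz, squeeze_zero hbd0 hbd hr⟩
  · obtain ⟨ha, hb⟩ := hna hH
    have hr := TendsToZeroExpFast.partial_sums
      (y := fun n => (numReducedWordsLE H n : ℝ)) (fun n => Nat.cast_nonneg _) hr0 hr1 hq1 ha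
    have hz := TendsToZeroExpFast.partial_sums
      (y := fun n => (numWordsLE H n : ℝ)) (fun n => Nat.cast_nonneg _) hz0 hz1 hd1 hb
    -- Finite index is excluded because the normalised counts of all words tend to 0.
    exact ⟨fun hfi => hfin_b hfi hb.2.1, ha, hr, hb, hz, hz.mono hwd0 hwd, hr.mono hbd0 hbd⟩
  · have hler := partial_sums_le_of_le (y := fun n => (numReducedWordsLE H n : ℝ))
      hr0 hr1 hq1 zero_le_two hle_a
    have hlez := partial_sums_le_of_le (y := fun n => (numWordsLE H n : ℝ))
      hz0 hz1 hd1 zero_le_one hle_b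
    have ha0 : ∀ n, 0 ≤ (numReducedWords H n : ℝ) / (2 * (k : ℝ) - 1) ^ n := fun n =>
      div_nonneg (Nat.cast_nonneg _) (hqn n).le
    have hb0 : ∀ n, 0 ≤ (numWords H n : ℝ) / (2 * (k : ℝ)) ^ n := fun n => by positivity
    refine ⟨limsup_pos_of_not_tendsto ha0 (fun n => (div_le_iff₀ (hqn n)).2 (hle_a n)) (hfin_a hH),
      limsup_pos_of_not_tendsto (fun n => div_nonneg (Nat.cast_nonneg _) (hqn n).le)
        (fun n => (div_le_iff₀ (hqn n)).2 (hler n)) fun h =>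
          hfin_a hH (squeeze_zero ha0 (fun n => ?_) h),
      limsup_pos_of_not_tendsto hb0 (fun n => (div_le_iff₀ (by positivity)).2 (hle_b n))
        (hfin_b hH),
      limsup_pos_of_not_tendsto (fun n => by positivity)
        (fun n => (div_le_iff₀ (by positivity)).2 (hlez n)) fun h =>
          hfin_b hH (squeeze_zero hb0 (fun n => ?_) h)⟩
    · have := hqn n
      gcongr
      exact numReducedWords_le_numReducedWordsLE n
    · gcongr
      exact numWords_le_numWordsLE n
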